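/- Permutations of length $n$ are written in one-line notation. For a permutation $\pi$ of length $n$ let $c(\pi)(j)=n+1-\pi(j)$. For $\pi$ of length $n$ and $\sigma$ of length $m$ let $\pi\oplus\sigma$ be the word $\pi(1),\dots,\pi(n),n+\sigma(1),\dots,n+\sigma(m)$ and let $\pi\ominus\sigma$ be the word $m+\pi(1),\dots,m+\pi(n),\sigma(1),\dots,\sigma(m)$. Write $\emptyset$ for the empty permutation and $@$ for the antipermutation, a formal permutation of length $-1$ with $c(@)=@$ and $1\oplus @=@\oplus 1=1\ominus @=@\ominus 1=\emptyset$. Write $\pi^e$ (resp. $\pi^o$) for the permutation that $\pi$ induces on its even (resp. odd) entries, with $@^e=@$ and $@^o=\emptyset$. A complete Baxter permutation is a permutation $\pi$ of odd length such that $\pi(i)$ is even if and only if $i$ is even, and such that whenever $\pi(x)=i$, $\pi(y)=i+1$ and $z$ lies strictly between $x$ and $y$, we have $\pi(z)<i$ if $i$ is odd and $\pi(z)>i+1$ if $i$ is even. A permutation $\sigma$ is alternating if $\sigma(1)<\sigma(2)>\sigma(3)<\cdots$, and doubly alternating if $\sigma$ and $\sigma^{-1}$ are both alternating. A snow leopard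 permutation is a permutation of the form $\pi^e$, where $\pi$ is a complete Baxter permutation such that $\pi^o$ is doubly alternating; by convention $@$ is also a snow leopard permutation. An even (resp. odd) thread is $\pi^e$ (resp. $\pi^o$) for a snow leopard permutation $\pi$ of odd length (possibly $\pi=@$). A Janus thread is a permutation that is both an even thread and an odd thread; $@$ is also regarded as a Janus thread. Let $JT_n$ be the set of Janus threads of length $n$, for $n\ge -1$. A Motzkin path of length $n$ is a lattice path from $(0,0)$ to $(n,0)$ with steps $U=(1,1)$, $D=(1,-1)$, $L=(1,0)$ that does not pass below the $x$-axis. It is peakless if no $U$ is immediately followed by a $D$. Let $UD_n$ be the set of peakless Motzkin paths of length $n$. **Theorem 6.4.** For all Janus threads $\gamma_1,\gamma_2$, the permutation $1\ominus\gamma_1$ is a Janus thread, and so is $(1\oplus c(\gamma_1)\oplus 1)\ominus(1\ominus\gamma_2)$ if $\gamma_1$ has nonnegative length. There is a unique map $K$ from the set of all Janus threads to the set of all peakless Motzkin paths that restricts to a bijection $K:JT_n\to UD_{n+1}$ for every integer $n\ge -1$ and satisfies * $K(@)=\emptyset$ (the empty path) and $K(\emptyset)=L$; * $K(1\ominus\gamma_1)=L\,K(\gamma_1)$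 for every Janus thread $\gamma_1$; * $K\bigl((1\oplus c(\gamma_1)\oplus 1)\ominus(1\ominus\gamma_2)\bigr)=U\,K(\gamma_1)\,D\,K(\gamma_2)$ for all Janus threads $\gamma_1,\gamma_2$ such that $\gamma_1$ has nonnegative length. -/

import Mathlib

namespace JanusThreads

/-! ### Permutations in one-line notation -/

/-- A permutation of length `n` in one-line notation: a word in which each of `1, …, n`
occurs exactly once. -/
def IsPermutation (w : List ℕ) : Prop :=
  w.Perm (List.range' 1 w.length)

/-- The entry `w(i)`, with positions numbered from `1`; it is only used for `1 ≤ i ≤ |w|`. -/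
def entry (w : List ℕ) (i : ℕ) : ℕ := w.getD (i - 1) 0

/-- The inverse of a permutation, in one-line notation: its entry at `v` is the position of the
entry `v` of `w`. -/
def inverse (w : List ℕ) : List ℕ :=
  (List.range' 1 w.length).map (fun v => w.idxOf v + 1)

/-- The permutation induced on the even entries: the even entries `2, 4, …`, in the order
in which they appear, relabelled `1, 2, …`. -/
def evenWord (w : List ℕ) : List ℕ :=
  (w.filter (fun x => x % 2 = 0)).map (fun x => x / 2)

/-- The permutation induced on the odd entries: the odd entries `1, 3, …`, in the order
in which they appear, relabelled `1, 2, …`. -/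
def oddWord (w : List ℕ) : List ℕ :=
  (w.filter (fun x => x % 2 = 1)).map (fun x => (x + 1) / 2)

/-- The complement `c(w)(j) = n + 1 - w(j)`. -/
def complWord (w : List ℕ) : List ℕ := w.map (fun x => w.length + 1 - x)

/-- The direct sum `u ⊕ v` of permutations. -/
def directSumWord (u v : List ℕ) : List ℕ := u ++ v.map (fun x => u.length + x)

/-- The skew sum `u ⊖ v` of permutations. -/
def skewSumWord (u v : List ℕ) : List ℕ := u.map (fun x => v.length + x) ++ v

/-! ### Baxter permutations and snow leopard permutations -/

/-- Complete Baxter permutations: permutations of odd length that preserve parity and such that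
whenever `w(x) = i`, `w(y) = i + 1` and `z` is strictly between `x` and `y`, one has `w(z) < i`
if `i` is odd and `w(z) > i + 1` if `i` is even. -/
def IsCompleteBaxter (w : List ℕ) : Prop :=
  IsPermutation w ∧ Odd w.length ∧
  (∀ i, 1 ≤ i → i ≤ w.length → (Even (entry w i) ↔ Even i)) ∧
  ∀ i x y z, 1 ≤ x → x ≤ w.length → 1 ≤ y → y ≤ w.length →
    entry w x = i → entry w y = i + 1 → ((x < z ∧ z < y) ∨ (y < z ∧ z < x)) →
    (Odd i → entry w z < i) ∧ (Even i → i + 1 < entry w z)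

/-- (Reduced) Baxter permutations. -/
def IsBaxter (u : List ℕ) : Prop := ∃ w, IsCompleteBaxter w ∧ oddWord w = u

/-- Anti-Baxter permutations. -/
def IsAntiBaxter (v : List ℕ) : Prop := ∃ w, IsCompleteBaxter w ∧ evenWord w = v

/-- Compatibility of a Baxter permutation `u` with an anti-Baxter permutation `v`. -/
def Compatible (u v : List ℕ) : Prop :=
  ∃ w, IsCompleteBaxter w ∧ oddWord w = u ∧ evenWord w = v

/-- Alternating (up-down) permutations: `w(1) < w(2) > w(3) < ⋯`. -/
def IsAlternating (w : List ℕ) : Prop :=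
  ∀ i, 1 ≤ i → i + 1 ≤ w.length →
    (Odd i → entry w i < entry w (i + 1)) ∧ (Even i → entry w (i + 1) < entry w i)

/-- Doubly alternating permutations: alternating permutations whose inverse is alternating. -/
def IsDoublyAlternating (w : List ℕ) : Prop :=
  IsAlternating w ∧ IsAlternating (inverse w)

/-- Snow leopard permutations of nonnegative length: anti-Baxter permutations that are compatible
with a doubly alternating Baxter permutation. -/
def IsSnowLeopardWord (v : List ℕ) : Prop :=
  IsAntiBaxter v ∧ ∃ u, IsBaxter u ∧ IsDoublyAlternating u ∧ Compatible u v

/-! ### The antipermutation, threads and Janus threads -/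

/-- The objects `@` (the antipermutation, of length `-1`) and `ofWord w`, a word `w`. Which words
are meant is always determined by a predicate below. -/
inductive PermWord where
  | anti : PermWord
  | ofWord : List ℕ → PermWord

namespace PermWord

/-- The length; `@` has length `-1`. -/
def length : PermWord → ℤ
  | anti => -1
  | ofWord w => w.length

/-- The empty permutation. -/
def empty : PermWord := ofWord []

/-- The permutation `1` of length one. -/
def one : PermWord := ofWord [1]

/-- The complement, with `c(@) = @`. -/
def compl : PermWord → PermWord
  | anti => anti
  | ofWord w => ofWord (complWord w)

/-- The direct sum, with `1 ⊕ @ = @ ⊕ 1 = ∅`. The remaining sums with `@` are not defined in the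
theory; the value given to them is irrelevant. -/
def directSum : PermWord → PermWord → PermWord
  | ofWord u, ofWord v => ofWord (directSumWord u v)
  | ofWord [1], anti => empty
  | anti, ofWord [1] => empty
  | _, _ => anti

/-- The skew sum, with `1 ⊖ @ = @ ⊖ 1 = ∅`. The remaining sums with `@` are not defined in the
theory; the value given to them is irrelevant. -/
def skewSum : PermWord → PermWord → PermWord
  | ofWord u, ofWord v => ofWord (skewSumWord u v)
  | ofWord [1], anti => empty
  | anti, ofWord [1] => empty
  | _, _ => anti

/-- The permutation induced on the even entries; by convention `@` induces `@`. -/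
def evenPart : PermWord → PermWord
  | anti => anti
  | ofWord w => ofWord (evenWord w)

/-- The permutation induced on the odd entries; by convention `@` induces `∅`. -/
def oddPart : PermWord → PermWord
  | anti => empty
  | ofWord w => ofWord (oddWord w)

/-- Snow leopard permutations; by convention `@` is one of them. -/
def IsSnowLeopard : PermWord → Prop
  | anti => True
  | ofWord w => IsSnowLeopardWord w

/-- Even threads: permutations induced on the even entries of a snow leopard permutation of odd
length (possibly `-1`). -/
def IsEvenThread (s : PermWord) : Prop :=
  ∃ p : PermWord, p.IsSnowLeopard ∧ Odd p.length ∧ p.evenPart = s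

/-- Odd threads: permutations induced on the odd entries of a snow leopard permutation of odd
length (possibly `-1`). -/
def IsOddThread (s : PermWord) : Prop :=
  ∃ p : PermWord, p.IsSnowLeopard ∧ Odd p.length ∧ p.oddPart = s

/-- Janus threads: the permutations that are both even and odd threads, together with `@`. -/
def IsJanusThread (s : PermWord) : Prop :=
  s = anti ∨ (s.IsEvenThread ∧ s.IsOddThread)

end PermWord

/-- The type of all Janus threads. -/
def JanusThread : Type := {g : PermWord // g.IsJanusThread}

/-- The set of Janus threads of length `n`. -/
def JT (n : ℤ) : Set JanusThread := {g | g.1.length = n}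

/-! ### Peakless Motzkin paths -/

/-- Up, Level and Down steps. -/
inductive Step where
  | U : Step
  | L : Step
  | D : Step

/-- The change of height along a step. -/
def Step.rise : Step → ℤ
  | Step.U => 1
  | Step.L => 0
  | Step.D => -1

/-- The final height of a sequence of steps that starts at height `0`. -/
def height (p : List Step) : ℤ := (p.map Step.rise).sum

/-- Motzkin paths: they never go below height `0` and end at height `0`. -/
def IsMotzkin (p : List Step) : Prop :=
  (∀ q, q <+: p → 0 ≤ height q) ∧ height p = 0

/-- No Up step is immediately followed by a Down step. -/
def IsPeakless (p : List Step) : Prop := ¬ [Step.U, Step.D] <:+: p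

/-- The type of all peakless Motzkin paths. -/
def PeaklessMotzkinPath : Type := {p : List Step // IsMotzkin p ∧ IsPeakless p}

/-- The set of peakless Motzkin paths of length `n`. -/
def UD (n : ℤ) : Set PeaklessMotzkinPath := {p | (p.1.length : ℤ) = n}

end JanusThreads

namespace JanusThreads

-- Replacing a thread `γ` by `1 ⊖ γ` absorbs the antipermutation, since `1 ⊖ @ = ∅`
-- (`PermWord.prime`). Everything then becomes a statement about words without exceptional cases,
-- and lengths agree with those of the paths.
--
-- The first half finds a grammar for threads. A snow leopard permutation of odd length comes from a
-- complete Baxter permutation `w` of length `4m - 1`. At an even position `k` the Baxter condition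
-- forces `w(k) - 1` and `w(k) + 1` onto opposite sides of `k`, and the odd part ascends at `k`
-- exactly when its inverse ascends at the value `w(k)`. Double alternation therefore means `w(k) ≡
-- k` modulo 4 and prescribes the two sides; `IsLeopardMap` records this. A counting argument
-- (`exists_block`) shows that such a map splits as a skew sum after an initial block, and stripping
-- the border of that block leaves a complemented smaller map (`exists_join`; the converse is
-- `isLeopardMap_join`). Reading this recursion at positions 0 and 2 modulo 4 gives the mutually
-- recursive grammar `Thread`.
--
-- The second half intersects the two languages. A word whose first entry is below its last is skew
-- indecomposable, so an even and an odd derivation of the same word must cut it at the same places.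
-- Hence the words in both languages are those of `JanusTree`: empty, `1 ⊖ t`, or `1 ⊖ (c(s) ⊕ 1) ⊖
-- t`. The term is unique once `s` is nonempty, because an arch over the empty word is a double
-- `lev`.
--
-- First-return decomposition describes Motzkin paths by the same terms, and "`s` nonempty" is
-- exactly peaklessness. The map `K` sends the word of a term to its path. Uniqueness holds because
-- the prescribed recursions determine `K` along every term.

local infixr:65 " ⊖ʷ " => skewSumWord
local infixr:65 " ⊕ʷ " => directSumWord

/-! ### Sums and complements of words -/

@[simp] theorem length_skewSumWord (u v : List ℕ) : (u ⊖ʷ v).length = u.length + v.length := by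
  simp [skewSumWord]

@[simp] theorem length_directSumWord (u v : List ℕ) :
    (u ⊕ʷ v).length = u.length + v.length := by
  simp [directSumWord]

@[simp] theorem length_complWord (u : List ℕ) : (complWord u).length = u.length := by
  simp [complWord]

@[simp] theorem nil_skewSumWord (v : List ℕ) : [] ⊖ʷ v = v := by simp [skewSumWord]

@[simp] theorem skewSumWord_nil (u : List ℕ) : u ⊖ʷ [] = u := by simp [skewSumWord]

@[simp] theorem directSumWord_nil (u : List ℕ) : u ⊕ʷ [] = u := by simp [directSumWord]

@[simp] theorem complWord_nil : complWord [] = [] := rfl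

theorem skewSumWord_assoc (u v w : List ℕ) : (u ⊖ʷ v) ⊖ʷ w = u ⊖ʷ (v ⊖ʷ w) := by
  simp only [skewSumWord, List.map_append, List.map_map, List.length_append, List.length_map,
    List.append_assoc]
  congr 1
  apply List.map_congr_left
  intro x _
  simp only [Function.comp]
  omega

/-- The entries of `w` lie between `1` and the length of `w`. -/
def IsBounded (w : List ℕ) : Prop := ∀ x ∈ w, 1 ≤ x ∧ x ≤ w.length

theorem isBounded_nil : IsBounded [] := by simp [IsBounded]

theorem isBounded_one : IsBounded [1] := by simp [IsBounded]

theorem IsBounded.skewSumWord {u v : List ℕ} (hu : IsBounded u) (hv : IsBounded v) :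
    IsBounded (u ⊖ʷ v) := by
  intro x hx
  simp only [JanusThreads.skewSumWord, List.mem_append, List.mem_map] at hx
  rw [length_skewSumWord]
  rcases hx with ⟨y, hy, rfl⟩ | hx
  · have := hu y hy
    omega
  · have := hv x hx
    omega

theorem IsBounded.directSumWord {u v : List ℕ} (hu : IsBounded u) (hv : IsBounded v) :
    IsBounded (u ⊕ʷ v) := by
  intro x hx
  simp only [JanusThreads.directSumWord, List.mem_append, List.mem_map] at hx
  rw [length_directSumWord]
  rcases hx with hx | ⟨y, hy, rfl⟩
  · have := hu x hx
    omega
  · have := hv y hy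
    omega

theorem IsBounded.complWord {u : List ℕ} (hu : IsBounded u) : IsBounded (complWord u) := by
  intro x hx
  rw [length_complWord]
  simp only [JanusThreads.complWord, List.mem_map] at hx
  obtain ⟨y, hy, rfl⟩ := hx
  have := hu y hy
  omega

theorem IsBounded.complWord_complWord {u : List ℕ} (hu : IsBounded u) :
    JanusThreads.complWord (JanusThreads.complWord u) = u := by
  unfold JanusThreads.complWord
  rw [List.map_map, List.length_map]
  conv_rhs => rw [← List.map_id u]
  apply List.map_congr_left
  intro x hx
  have := hu x hx
  simp only [Function.comp, id]
  omega

theorem complWord_skewSumWord (u : List ℕ) {v : List ℕ} (hv : IsBounded v) :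
    complWord (u ⊖ʷ v) = complWord u ⊕ʷ complWord v := by
  simp only [skewSumWord, directSumWord, complWord, List.map_append, List.map_map,
    List.length_append, List.length_map]
  congr 1 <;> apply List.map_congr_left <;> intro x hx <;> simp only [Function.comp]
  · omega
  · have := hv x hx
    omega

theorem complWord_directSumWord {u : List ℕ} (hu : IsBounded u) (v : List ℕ) :
    complWord (u ⊕ʷ v) = complWord u ⊖ʷ complWord v := by
  simp only [skewSumWord, directSumWord, complWord, List.map_append, List.map_map,
    List.length_append, List.length_map]
  congr 1 <;> apply List.map_congr_left <;> intro x hx <;> simp only [Function.comp]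
  · have := hu x hx
    omega
  · omega

theorem complWord_one : complWord [1] = [1] := rfl

theorem map_add_left_inj {a b : List ℕ} {n : ℕ}
    (h : a.map (fun x => n + x) = b.map (fun x => n + x)) : a = b :=
  List.map_injective_iff.2 (add_right_injective n) h

theorem skewSumWord_cancel {u v u' v' : List ℕ} (h : u ⊖ʷ v = u' ⊖ʷ v')
    (hl : u.length = u'.length) : u = u' ∧ v = v' := by
  obtain ⟨h₁, rfl⟩ := List.append_inj h (by simpa using hl)
  exact ⟨map_add_left_inj h₁, rfl⟩

/-- The first entry is smaller than the last one; such a word is skew indecomposable. -/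
def Rises (u : List ℕ) : Prop :=
  ∃ a b, u[0]? = some a ∧ u[u.length - 1]? = some b ∧ a < b

theorem Rises.two_le_length {u : List ℕ} (h : Rises u) : 2 ≤ u.length := by
  obtain ⟨a, b, ha, hb, hab⟩ := h
  by_contra hlt
  have : u.length - 1 = 0 := by omega
  rw [this, ha] at hb
  simp at hb
  omega

theorem Rises.directSumWord {u v : List ℕ} (hu : IsBounded u) (hv : IsBounded v)
    (hu0 : u ≠ []) (hv0 : v ≠ []) : Rises (u ⊕ʷ v) := by
  have h1 := List.length_pos_of_ne_nil hu0
  have h2 := List.length_pos_of_ne_nil hv0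
  have h3 := hu u[0] (List.getElem_mem h1)
  have h4 := hv (v[v.length - 1]) (List.getElem_mem (by omega))
  refine ⟨u[0], u.length + v[v.length - 1], ?_, ?_, by omega⟩
  · simp [JanusThreads.directSumWord, List.getElem?_append_left h1]
  · rw [length_directSumWord, JanusThreads.directSumWord, List.getElem?_append_right (by omega),
      List.getElem?_map, show u.length + v.length - 1 - u.length = v.length - 1 by omega,
      List.getElem?_eq_getElem (by omega)]
    rfl

/-- If `u` reached past `u'`, its first entry would lie in the high block `u'` and its last entry in
the low block `v'`, so `u` could not rise. -/
theorem Rises.length_le {u v u' v' : List ℕ} (h : Rises u) (hu' : IsBounded u')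
    (hv' : IsBounded v') (h0 : u' ≠ []) (he : u ⊖ʷ v = u' ⊖ʷ v') : u.length ≤ u'.length := by
  by_contra hlt
  push Not at hlt
  obtain ⟨a, b, ha, hb, hab⟩ := h
  have h1 := List.length_pos_of_ne_nil h0
  have hl := congrArg List.length he
  simp only [length_skewSumWord] at hl
  have e1 : (u ⊖ʷ v)[0]? = some (v.length + a) := by
    rw [skewSumWord, List.getElem?_append_left (by simp; omega), List.getElem?_map, ha]
    rfl
  have e2 : (u ⊖ʷ v)[u.length - 1]? = some (v.length + b) := by
    rw [skewSumWord, List.getElem?_append_left (by simp; omega), List.getElem?_map, hb]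
    rfl
  have f1 : (u' ⊖ʷ v')[0]? = some (v'.length + u'[0]) := by
    rw [skewSumWord, List.getElem?_append_left (by simpa), List.getElem?_map,
      List.getElem?_eq_getElem h1]
    rfl
  have hi : u.length - 1 - u'.length < v'.length := by omega
  have f2 : (u' ⊖ʷ v')[u.length - 1]? = some (v'[u.length - 1 - u'.length]) := by
    rw [skewSumWord, List.getElem?_append_right (by simp; omega), List.length_map,
      List.getElem?_eq_getElem hi]
  have g1 := hu' _ (List.getElem_mem h1)
  have g2 := hv' _ (List.getElem_mem hi)
  rw [he, f1] at e1
  rw [he, f2] at e2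
  simp only [Option.some.injEq] at e1 e2
  omega

/-- A skew sum determines its first summand if that summand rises. -/
theorem Rises.skewSumWord_cancel {u v u' v' : List ℕ} (h : Rises u) (h' : Rises u')
    (hu : IsBounded u) (hv : IsBounded v) (hu' : IsBounded u') (hv' : IsBounded v')
    (he : u ⊖ʷ v = u' ⊖ʷ v') : u = u' ∧ v = v' := by
  have h1 := h.two_le_length
  have h2 := h'.two_le_length
  refine JanusThreads.skewSumWord_cancel he (le_antisymm (h.length_le hu' hv' ?_ he)
    (h'.length_le hu hv ?_ he.symm)) <;> rintro rfl <;> simp at *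

theorem Rises.skewSumWord_ne {u v v' : List ℕ} (h : Rises u) (hv' : IsBounded v') :
    u ⊖ʷ v ≠ [1] ⊖ʷ v' := by
  intro he
  have := h.length_le isBounded_one hv' (by simp) he
  have := h.two_le_length
  simp at *
  omega

theorem Rises.ne_skewSumWord_one {u x : List ℕ} (h : Rises u) (hx : IsBounded x) :
    u ≠ x ⊖ʷ [1] := by
  rintro rfl
  have hl := h.two_le_length
  have h0 : x ≠ [] := by
    rintro rfl
    simp at hl
  have := h.length_le (v := []) hx isBounded_one h0 (by simp)
  simp at this

/-! ### The grammar of even and odd threads -/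

/-- `Thread false` consists of the odd threads, and `Thread true` of the words `1 ⊖ e` for an even
thread `e`. -/
inductive Thread : Bool → List ℕ → Prop
  | nil (b : Bool) : Thread b []
  | even {o e : List ℕ} : Thread false o → Thread true e → Thread true ([1] ⊖ʷ (complWord o ⊖ʷ e))
  | odd {e o : List ℕ} : Thread true e → Thread false o → Thread false ((complWord e ⊕ʷ [1]) ⊖ʷ o)

theorem Thread.isBounded {b : Bool} {w : List ℕ} (h : Thread b w) : IsBounded w := by
  induction h with
  | nil => exact isBounded_nil
  | even _ _ ho he => exact isBounded_one.skewSumWord (ho.complWord.skewSumWord he)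
  | odd _ _ he ho => exact (he.complWord.directSumWord isBounded_one).skewSumWord ho

theorem Thread.one (b : Bool) : Thread b [1] := by
  cases b
  · exact Thread.odd (Thread.nil _) (Thread.nil _)
  · exact Thread.even (Thread.nil _) (Thread.nil _)

/-- Both rules add material on the left, so a derivation of `v` can replace the terminal `nil` in
the derivation of `u`. -/
theorem Thread.append {b : Bool} {u v : List ℕ} (hu : Thread b u) (hv : Thread b v) :
    Thread b (u ⊖ʷ v) := by
  induction hu with
  | nil => simpa
  | even ho _ _ ihe =>
    rw [skewSumWord_assoc, skewSumWord_assoc]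
    exact Thread.even ho (ihe hv)
  | odd he _ _ iho =>
    rw [skewSumWord_assoc]
    exact Thread.odd he (iho hv)

theorem rises_complWord_directSumWord_one {e : List ℕ} (he : IsBounded e) (h0 : e ≠ []) :
    Rises (complWord e ⊕ʷ [1]) := by
  refine Rises.directSumWord he.complWord isBounded_one ?_ (by simp)
  intro h
  apply h0
  simpa [complWord] using h

theorem Thread.isBounded_of_one_skewSumWord {v : List ℕ} (h : Thread true ([1] ⊖ʷ v)) :
    IsBounded v := by
  generalize hw : [1] ⊖ʷ v = w at h
  cases h with
  | nil =>
    have := congrArg List.length hw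
    simp at this
  | even ho he =>
    obtain ⟨_, rfl⟩ := JanusThreads.skewSumWord_cancel hw rfl
    exact ho.isBounded.complWord.skewSumWord he.isBounded

/-- The first factor `c(e) ⊕ 1` of an odd thread rises unless `e` is empty, and a rising factor
cannot start a word `1 ⊖ v`. So the first factor is exactly `1`. -/
theorem Thread.of_one_skewSumWord {v : List ℕ} (hv : IsBounded v)
    (h : Thread false ([1] ⊖ʷ v)) : Thread false v := by
  generalize hw : [1] ⊖ʷ v = w at h
  cases h with
  | nil =>
    have := congrArg List.length hw
    simp at this
  | @odd e o he ho =>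
    by_cases h0 : e = []
    · subst h0
      obtain ⟨_, rfl⟩ := JanusThreads.skewSumWord_cancel hw rfl
      exact ho
    · exact absurd hw.symm
        ((rises_complWord_directSumWord_one he.isBounded h0).skewSumWord_ne hv)

/-- The final entry 1 belongs to the nonempty word `v`. The other entries of `v` also occur in the
shifted copy of `x`, so they are at least 2 and can be lowered by one. -/
theorem exists_of_skewSumWord_eq_skewSumWord_one {u v x : List ℕ} (hv : IsBounded v)
    (hx : IsBounded x) (h0 : v ≠ []) (h : u ⊖ʷ v = x ⊖ʷ [1]) :
    ∃ y, IsBounded y ∧ v = y ⊖ʷ [1] ∧ x = u ⊖ʷ y := by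
  rcases List.eq_nil_or_concat v with rfl | ⟨v', c, rfl⟩
  · exact absurd rfl h0
  rw [List.concat_eq_append] at *
  simp only [skewSumWord, ← List.append_assoc] at h
  obtain ⟨h1, h2⟩ := List.append_inj' h rfl
  have hc : c = 1 := by simpa using h2
  subst hc
  have hv' : ∀ z ∈ v', 2 ≤ z := by
    intro z hz
    have : z ∈ x.map (fun x => [1].length + x) := by
      rw [← h1]
      simp [hz]
    obtain ⟨t, ht, rfl⟩ := List.mem_map.1 this
    have := hx t ht
    simp
    omega
  have hy : (v'.map (fun z => z - 1)).map (fun z => 1 + z) = v' := by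
    rw [List.map_map]
    conv_rhs => rw [← List.map_id v']
    apply List.map_congr_left
    intro z hz
    have := hv' z hz
    simp only [Function.comp, id]
    omega
  refine ⟨v'.map (fun z => z - 1), ?_, ?_, ?_⟩
  · intro z hz
    obtain ⟨t, ht, rfl⟩ := List.mem_map.1 hz
    have h3 := hv' t ht
    have h4 := hv t (by simp [ht])
    simp at h4 ⊢
    omega
  · simp only [skewSumWord, List.length_singleton]
    rw [hy]
  · apply map_add_left_inj (n := 1)
    simp only [List.length_singleton] at h1
    rw [← h1, skewSumWord, List.map_append, hy, List.map_map]
    congr 1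
    apply List.map_congr_left
    intro z _
    simp only [Function.comp, List.length_append, List.length_map, List.length_singleton]
    omega

/-- The trailing 1 is passed down to the last factor `c(e) ⊕ 1` of the odd thread. That factor must
be `1` itself, since a rising word is not of the form `x ⊖ 1`. -/
theorem Thread.of_skewSumWord_one {x w : List ℕ} (h : Thread false w) (hx : IsBounded x)
    (hw : w = x ⊖ʷ [1]) : Thread false x := by
  generalize hb : false = b at h
  induction h generalizing x with
  | nil =>
    have := congrArg List.length hw
    simp at this
  | even => simp at hb
  | @odd e o he ho _ iho =>
    by_cases ho0 : o = []
    · subst ho0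
      by_cases h0 : e = []
      · subst h0
        have hl := congrArg List.length hw
        simp at hl
        subst hl
        exact Thread.nil _
      · rw [skewSumWord_nil] at hw
        exact absurd hw ((rises_complWord_directSumWord_one he.isBounded h0).ne_skewSumWord_one hx)
    · obtain ⟨y, hy, ho', rfl⟩ :=
        exists_of_skewSumWord_eq_skewSumWord_one ho.isBounded hx ho0 hw
      exact Thread.odd he (iho hy ho' rfl)

/-! ### The grammar of Janus threads -/

/-- Terms for Janus threads and for Motzkin paths. -/
inductive JanusTree
  | nil : JanusTree
  | lev : JanusTree → JanusTree
  | arch : JanusTree → JanusTree → JanusTree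

namespace JanusTree

/-- The terms of peakless paths: nothing is an arch over the empty path. -/
def Good : JanusTree → Prop
  | nil => True
  | lev t => t.Good
  | arch s t => s ≠ nil ∧ s.Good ∧ t.Good

/-- The word `1 ⊖ γ` of the Janus thread `γ` that is described by a term. -/
def word : JanusTree → List ℕ
  | nil => []
  | lev t => [1] ⊖ʷ t.word
  | arch s t => [1] ⊖ʷ ((complWord s.word ⊕ʷ [1]) ⊖ʷ t.word)

theorem word_eq_nil {t : JanusTree} : t.word = [] ↔ t = nil := by
  cases t <;> simp [word, skewSumWord]

/-- An arch has two readings. As an odd thread it is the factor `1` followed by the factor `c(s) ⊕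
1`; as an even thread it uses `c(s) ⊕ 1 = c(s ⊖ 1)`, where `s ⊖ 1` is again an odd thread. -/
theorem thread_word (t : JanusTree) : ∀ b, Thread b t.word := by
  induction t with
  | nil => exact Thread.nil
  | lev t ih =>
    intro b
    exact (Thread.one b).append (ih b)
  | arch s t ihs iht =>
    intro b
    cases b
    · exact (Thread.one _).append (Thread.odd (ihs true) (iht false))
    · have := Thread.even ((ihs false).append (Thread.one false)) (iht true)
      rwa [complWord_skewSumWord _ isBounded_one, complWord_one] at this

theorem isBounded_word (t : JanusTree) : IsBounded t.word := (t.thread_word true).isBounded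

theorem rises_word {s : JanusTree} (hs : s ≠ nil) : Rises (complWord s.word ⊕ʷ [1]) :=
  rises_complWord_directSumWord_one s.isBounded_word (by rwa [Ne, word_eq_nil])

theorem word_ne_rising {t : JanusTree} {u v : List ℕ} (hu : Rises u) :
    t.word ≠ u ⊖ʷ v := by
  intro h
  cases t with
  | nil =>
    have h1 := hu.two_le_length
    have := congrArg List.length h
    simp only [word, List.length_nil, length_skewSumWord] at this
    omega
  | lev t => exact hu.skewSumWord_ne t.isBounded_word h.symm
  | arch s t =>
    exact hu.skewSumWord_ne ((s.isBounded_word.complWord.directSumWord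
      isBounded_one).skewSumWord t.isBounded_word) h.symm

/-- After the leading `1`, a good arch continues with a rising factor, while the word under a `lev`
is empty or starts with another `1`. This separates the two constructors, and indecomposability of
the rising factor separates `s` from `t`. -/
theorem word_injective : ∀ {t t' : JanusTree}, t.Good → t'.Good → t.word = t'.word → t = t'
  | nil, t', _, _, h => (word_eq_nil.1 h.symm).symm
  | t, nil, _, _, h => word_eq_nil.1 h
  | lev t, lev t', ht, ht', h => by
    rw [word_injective (t := t) (t' := t') ht ht' (skewSumWord_cancel h rfl).2]
  | lev t, arch s' t', _, ht', h =>
    absurd (skewSumWord_cancel h rfl).2 (word_ne_rising (rises_word ht'.1))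
  | arch s t, lev t', ht, _, h =>
    absurd (skewSumWord_cancel h.symm rfl).2 (word_ne_rising (rises_word ht.1))
  | arch s t, arch s' t', ht, ht', h => by
    obtain ⟨h1, h2⟩ := (rises_word ht.1).skewSumWord_cancel (rises_word ht'.1)
      (s.isBounded_word.complWord.directSumWord isBounded_one) t.isBounded_word
      (s'.isBounded_word.complWord.directSumWord isBounded_one) t'.isBounded_word
      (skewSumWord_cancel h rfl).2
    have h3 := congrArg complWord (List.append_inj' h1 rfl).1
    rw [s.isBounded_word.complWord_complWord, s'.isBounded_word.complWord_complWord] at h3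
    rw [word_injective ht.2.1 ht'.2.1 h3, word_injective ht.2.2 ht'.2.2 h2]

/-- The even derivation gives `w = 1 ⊖ c(o) ⊖ e`, and the odd language also contains `c(o) ⊖ e`.
Either `c(o) ⊖ e` is still in the even language, or `c(o)` is a rising factor that both derivations
must isolate; both cases pass to shorter words. -/
theorem exists_word_eq : ∀ (n : ℕ) (w : List ℕ), w.length ≤ n → Thread true w →
    Thread false w → ∃ t : JanusTree, t.Good ∧ t.word = w := by
  intro n
  induction n with
  | zero =>
    intro w hw _ _
    exact ⟨nil, trivial, (List.length_eq_zero_iff.1 (by omega)).symm⟩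
  | succ n ih =>
    intro w hw h h'
    cases h with
    | nil => exact ⟨nil, trivial, rfl⟩
    | @even o e ho he =>
      have hbc := ho.isBounded.complWord.skewSumWord he.isBounded
      have hz := h'.of_one_skewSumWord hbc
      simp only [length_skewSumWord, List.length_singleton, length_complWord] at hw
      suffices hlev : Thread true (complWord o ⊖ʷ e) ∨
          ∃ s t : JanusTree, s ≠ .nil ∧ s.Good ∧ t.Good ∧
            complWord o ⊖ʷ e = (complWord s.word ⊕ʷ [1]) ⊖ʷ t.word by
        rcases hlev with hlev | ⟨s, t, hs0, hs, ht, hst⟩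
        · obtain ⟨t, ht, htw⟩ := ih _ (by simp; omega) hlev hz
          exact ⟨lev t, ht, by rw [word, htw]⟩
        · exact ⟨arch s t, ⟨hs0, hs, ht⟩, by rw [word, hst]⟩
      cases ho with
      | nil => exact Or.inl (by simpa using he)
      | @odd e₁ o₁ he₁ ho₁ =>
        have hco : complWord ((complWord e₁ ⊕ʷ [1]) ⊖ʷ o₁) =
            (e₁ ⊖ʷ [1]) ⊕ʷ complWord o₁ := by
          rw [complWord_skewSumWord _ ho₁.isBounded,
            complWord_directSumWord he₁.isBounded.complWord,
            he₁.isBounded.complWord_complWord, complWord_one]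
        -- If `o₁` is empty then `c(o) = e₁ ⊖ 1`, and `e₁ ⊖ 1 ⊖ e` concatenates three words of the
        -- even language. Otherwise `c(o)` is a proper direct sum, hence rises.
        by_cases ho0 : o₁ = []
        · subst ho0
          left
          rw [hco, complWord_nil, directSumWord_nil, skewSumWord_assoc]
          exact he₁.append ((Thread.one true).append he)
        · right
          have hr : Rises ((e₁ ⊖ʷ [1]) ⊕ʷ complWord o₁) := by
            refine Rises.directSumWord (he₁.isBounded.skewSumWord isBounded_one)
              ho₁.isBounded.complWord ?_ ?_
            · simp [skewSumWord]
            · simpa [complWord] using ho0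
          rw [hco] at hz hbc ⊢
          generalize hgen : ((e₁ ⊖ʷ [1]) ⊕ʷ complWord o₁) ⊖ʷ e = z at hz
          cases hz with
          | nil =>
            have := congrArg List.length hgen
            simp at this
          | @odd e₃ o₃ he₃ ho₃ =>
            by_cases h0 : e₃ = []
            · subst h0
              exact absurd hgen (hr.skewSumWord_ne ho₃.isBounded)
            obtain ⟨h1, rfl⟩ := hr.skewSumWord_cancel
              (rises_complWord_directSumWord_one he₃.isBounded h0)
              ((he₁.isBounded.skewSumWord isBounded_one).directSumWord ho₁.isBounded.complWord)
              he.isBounded (he₃.isBounded.complWord.directSumWord isBounded_one) ho₃.isBounded hgen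
            -- Complementing the matched factors shows `o = e₃ ⊖ 1`. Removing the trailing 1 puts
            -- `e₃`, already in the even language, into the odd one as well.
            have h2 : (complWord e₁ ⊕ʷ [1]) ⊖ʷ o₁ = e₃ ⊖ʷ [1] := by
              have := congrArg complWord (hco.trans h1)
              rw [((he₁.isBounded.complWord.directSumWord isBounded_one).skewSumWord
                ho₁.isBounded).complWord_complWord,
                complWord_directSumWord he₃.isBounded.complWord,
                he₃.isBounded.complWord_complWord, complWord_one] at this
              exact this
            have h3 : Thread false e₃ :=
              (Thread.odd he₁ ho₁).of_skewSumWord_one he₃.isBounded h2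
            have hl := congrArg List.length h2
            simp only [length_skewSumWord, length_directSumWord, length_complWord,
              List.length_singleton] at hl hw
            obtain ⟨s, hs, rfl⟩ := ih e₃ (by omega) he₃ h3
            obtain ⟨t, ht, rfl⟩ := ih e (by omega) he ho₃
            refine ⟨s, t, fun h => h0 (word_eq_nil.2 h), hs, ht, rfl⟩

end JanusTree

/-! ### Complete Baxter permutations with doubly alternating odd part -/

/-- `f` restricts to a complete Baxter permutation of `1, …, 4m - 1` whose induced permutation on
the odd entries is doubly alternating, and is extended by `f 0 = 4m` and `f (4m) = 0`. -/
structure IsLeopardMap (m : ℕ) (f : ℕ → ℕ) : Prop where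
  zero : f 0 = 4 * m
  top : f (4 * m) = 0
  le : ∀ k ≤ 4 * m, f k ≤ 4 * m
  surj : ∀ v ≤ 4 * m, ∃ k ≤ 4 * m, f k = v
  odd : ∀ k ≤ 4 * m, k % 2 = 1 → f k % 2 = 1
  up : ∀ k ≤ 4 * m, k % 4 = 2 → f k % 4 = 2 ∧ ∃ x y, x < k ∧ k < y ∧ y ≤ 4 * m ∧
    f x + 1 = f k ∧ f y = f k + 1 ∧ (∀ z, x < z → z < k → f z < f k) ∧
    ∀ z, k < z → z < y → f k < f z
  down : ∀ k ≤ 4 * m, k % 4 = 0 → f k % 4 = 0 ∧ (0 < k → k < 4 * m → ∃ x y, x < k ∧ k < y ∧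
    y ≤ 4 * m ∧ f x = f k + 1 ∧ f y + 1 = f k ∧ (∀ z, x < z → z < k → f k < f z) ∧
    ∀ z, k < z → z < y → f z < f k)

namespace IsLeopardMap

variable {m : ℕ} {f : ℕ → ℕ}

theorem inj (h : IsLeopardMap m f) {x y : ℕ} (hx : x ≤ 4 * m) (hy : y ≤ 4 * m)
    (hxy : f x = f y) : x = y := by
  have hmaps : ∀ a ∈ Finset.Iic (4 * m), f a ∈ Finset.Iic (4 * m) := by
    simpa using h.le
  refine Finset.injOn_of_surjOn_of_card_le (s := Finset.Iic (4 * m)) f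
    (t := Finset.Iic (4 * m)) hmaps ?_ le_rfl (by simpa) (by simpa) hxy
  intro v hv
  obtain ⟨k, hk, rfl⟩ := h.surj v (by simpa using hv)
  exact ⟨k, by simpa using hk, rfl⟩

theorem isLeopardMap_zero : IsLeopardMap 0 (fun _ => 0) where
  zero := rfl
  top := rfl
  le := by simp
  surj v hv := ⟨0, by simp, by omega⟩
  odd k hk := by omega
  up k hk := by omega
  down k hk _ := ⟨rfl, by omega⟩

/-- The reverse complement. -/
theorem reverse_compl (h : IsLeopardMap m f) :
    IsLeopardMap m (fun k => 4 * m - f (4 * m - k)) where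
  zero := by simp [h.top]
  top := by simp [h.zero]
  le k _ := by omega
  surj v hv := by
    obtain ⟨k, hk, hkv⟩ := h.surj (4 * m - v) (by omega)
    refine ⟨4 * m - k, by omega, ?_⟩
    rw [show 4 * m - (4 * m - k) = k by omega]
    omega
  odd k hk hk2 := by
    have h1 := h.odd (4 * m - k) (by omega) (by omega)
    have h2 := h.le (4 * m - k) (by omega)
    omega
  up k hk hk4 := by
    obtain ⟨h1, x, y, hx, hy, hym, hfx, hfy, hl, hr⟩ := h.up (4 * m - k) (by omega) (by omega)
    have h2 := h.le (4 * m - k) (by omega)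
    have h3 := h.le y (by omega)
    refine ⟨by omega, 4 * m - y, 4 * m - x, by omega, by omega, by omega, ?_, ?_, ?_, ?_⟩
    · rw [show 4 * m - (4 * m - y) = y by omega]
      omega
    · rw [show 4 * m - (4 * m - x) = x by omega]
      omega
    · intro z hz hz'
      have := hr (4 * m - z) (by omega) (by omega)
      have := h.le (4 * m - z) (by omega)
      omega
    · intro z hz hz'
      have := hl (4 * m - z) (by omega) (by omega)
      omega
  down k hk hk4 := by
    obtain ⟨h1, h1'⟩ := h.down (4 * m - k) (by omega) (by omega)
    have h2 := h.le (4 * m - k) (by omega)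
    refine ⟨by omega, fun hk0 hkm => ?_⟩
    obtain ⟨x, y, hx, hy, hym, hfx, hfy, hl, hr⟩ := h1' (by omega) (by omega)
    have h3 := h.le x (by omega)
    refine ⟨4 * m - y, 4 * m - x, by omega, by omega, by omega, ?_, ?_, ?_, ?_⟩
    · rw [show 4 * m - (4 * m - y) = y by omega]
      omega
    · rw [show 4 * m - (4 * m - x) = x by omega]
      omega
    · intro z hz hz'
      have := hr (4 * m - z) (by omega) (by omega)
      omega
    · intro z hz hz'
      have := hl (4 * m - z) (by omega) (by omega)
      have := h.le (4 * m - z) (by omega)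
      omega

/-! ### Joining two leopard maps. -/

/-- The map of `(1 ⊕ 1 ⊕ c(h) ⊕ 1 ⊕ 1) ⊖ 1 ⊖ g`. -/
def join (a b : ℕ) (h g : ℕ → ℕ) (k : ℕ) : ℕ :=
  if k = 0 then 4 * (a + b + 1) else if k = 1 then 4 * b + 1 else
  if k ≤ 4 * a + 2 then 4 * b + 4 * a + 2 - h (k - 2) else
  if k = 4 * a + 3 then 4 * b + 4 * a + 3 else g (k - (4 * a + 4))

section join

variable {a b : ℕ} {h g : ℕ → ℕ}

theorem join_zero : join a b h g 0 = 4 * (a + b + 1) := rfl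

theorem join_one : join a b h g 1 = 4 * b + 1 := rfl

theorem join_mid {k : ℕ} (hk : k ≤ 4 * a) :
    join a b h g (k + 2) = 4 * b + 4 * a + 2 - h k := by
  simp [join, hk]

theorem join_last : join a b h g (4 * a + 3) = 4 * b + 4 * a + 3 := by
  simp [join]

theorem join_right (k : ℕ) : join a b h g (4 * a + 4 + k) = g k := by
  rw [join, if_neg (by omega), if_neg (by omega), if_neg (by omega), if_neg (by omega)]
  congr 1
  omega

end join

/-- On the middle block the shift of positions by 2 and the complement of values both exchange the
residues 0 and 2 modulo 4, so `up` there comes from `down` for `h` and conversely. The inserted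
entries supply the neighbours missing at the ends of `h` and at the start of `g`. -/
theorem isLeopardMap_join {a b : ℕ} {h g : ℕ → ℕ} (hh : IsLeopardMap a h)
    (hg : IsLeopardMap b g) : IsLeopardMap (a + b + 1) (join a b h g) := by
  have cases5 : ∀ k ≤ 4 * (a + b + 1), k = 0 ∨ k = 1 ∨ (∃ j ≤ 4 * a, k = j + 2) ∨
      k = 4 * a + 3 ∨ ∃ j ≤ 4 * b, k = 4 * a + 4 + j := by
    intro k hk
    by_cases h1 : 2 ≤ k ∧ k ≤ 4 * a + 2
    · exact Or.inr (Or.inr (Or.inl ⟨k - 2, by omega, by omega⟩))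
    · by_cases h2 : 4 * a + 4 ≤ k
      · exact Or.inr (Or.inr (Or.inr (Or.inr ⟨k - (4 * a + 4), by omega, by omega⟩)))
      · omega
  constructor
  · rfl
  · rw [show 4 * (a + b + 1) = 4 * a + 4 + 4 * b by omega, join_right, hg.top]
  · intro k hk
    rcases cases5 k hk with rfl | rfl | ⟨j, hj, rfl⟩ | rfl | ⟨j, hj, rfl⟩
    · rw [join_zero]
    · rw [join_one]
      omega
    · rw [join_mid hj]
      omega
    · rw [join_last]
      omega
    · rw [join_right]
      have := hg.le j hj
      omega
  · intro v hv
    by_cases h1 : v ≤ 4 * b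
    · obtain ⟨k, hk, rfl⟩ := hg.surj v h1
      exact ⟨4 * a + 4 + k, by omega, join_right k⟩
    by_cases h2 : v = 4 * b + 1
    · exact ⟨1, by omega, by rw [join_one, h2]⟩
    by_cases h3 : v ≤ 4 * b + 4 * a + 2
    · obtain ⟨k, hk, hkv⟩ := hh.surj (4 * b + 4 * a + 2 - v) (by omega)
      exact ⟨k + 2, by omega, by rw [join_mid hk]; omega⟩
    by_cases h4 : v = 4 * b + 4 * a + 3
    · exact ⟨4 * a + 3, by omega, by rw [join_last]; omega⟩
    · exact ⟨0, by omega, by rw [join_zero]; omega⟩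
  · intro k hk hk2
    rcases cases5 k hk with rfl | rfl | ⟨j, hj, rfl⟩ | rfl | ⟨j, hj, rfl⟩
    · omega
    · rw [join_one]
      omega
    · rw [join_mid hj]
      have := hh.le j hj
      have := hh.odd j hj (by omega)
      omega
    · rw [join_last]
      omega
    · rw [join_right]
      have := hg.odd j hj (by omega)
      omega
  · intro k hk hk4
    rcases cases5 k hk with rfl | rfl | ⟨j, hj, rfl⟩ | rfl | ⟨j, hj, rfl⟩
    · omega
    · omega
    · obtain ⟨hj4, hj'⟩ := hh.down j hj (by omega)
      have hjl := hh.le j hj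
      rw [join_mid hj]
      refine ⟨by omega, ?_⟩
      have hL : ∃ x < j + 2, join a b h g x + 1 = 4 * b + 4 * a + 2 - h j ∧
          ∀ z, x < z → z < j + 2 → join a b h g z < 4 * b + 4 * a + 2 - h j := by
        by_cases hj0 : j = 0
        · subst hj0
          refine ⟨1, by omega, ?_, fun z _ _ => by omega⟩
          rw [join_one, hh.zero]
          omega
        -- `down` says nothing about neighbours at the endpoints; at `j = 4a` the entry is 0, the
        -- minimum, so the entry 1 anywhere to its left will do.
        · have hx : ∃ x < j, h x = h j + 1 ∧ ∀ z, x < z → z < j → h j < h z := by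
            by_cases hja : j = 4 * a
            · have h1 := hh.top
              obtain ⟨x, hx, hx1⟩ := hh.surj 1 (by omega)
              have hxj : x ≠ j := by
                rintro rfl
                rw [hja] at hx1
                omega
              refine ⟨x, by omega, by rw [hja, h1, hx1], fun z hz hz' => ?_⟩
              rw [hja, h1]
              rcases Nat.eq_zero_or_pos (h z) with h0 | h0
              · have := hh.inj (x := z) (y := 4 * a) (by omega) le_rfl (by omega)
                omega
              · exact h0
            · obtain ⟨x, y, h1, h2, h3, h4, h5, h6, h7⟩ := hj' (by omega) (by omega)
              exact ⟨x, h1, h4, h6⟩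
          obtain ⟨x, hxj, hx, hz⟩ := hx
          have := hh.le x (by omega)
          refine ⟨x + 2, by omega, by rw [join_mid (by omega)]; omega, fun z hz1 hz2 => ?_⟩
          obtain ⟨z, rfl⟩ := Nat.exists_eq_add_of_le' (show 2 ≤ z by omega)
          have := hz z (by omega) (by omega)
          have := hh.le z (by omega)
          rw [join_mid (by omega)]
          omega
      have hR : ∃ y, j + 2 < y ∧ y ≤ 4 * a + 3 ∧
          join a b h g y = 4 * b + 4 * a + 2 - h j + 1 ∧
          ∀ z, j + 2 < z → z < y → 4 * b + 4 * a + 2 - h j < join a b h g z := by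
        by_cases hja : j = 4 * a
        · subst hja
          refine ⟨4 * a + 3, by omega, le_rfl, ?_, fun z _ _ => by omega⟩
          rw [join_last, hh.top]
          omega
        · have hy : ∃ y, j < y ∧ y ≤ 4 * a ∧ h y + 1 = h j ∧
              ∀ z, j < z → z < y → h z < h j := by
            by_cases hj0 : j = 0
            · subst hj0
              have h0 := hh.zero
              obtain ⟨y, hy, hy1⟩ := hh.surj (4 * a - 1) (by omega)
              have hy0 : y ≠ 0 := by
                rintro rfl
                omega
              refine ⟨y, by omega, hy, by omega, fun z hz hz' => ?_⟩
              rw [h0]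
              refine lt_of_le_of_ne (hh.le z (by omega)) fun he => ?_
              have := hh.inj (x := z) (y := 0) (by omega) (by omega) (by omega)
              omega
            · obtain ⟨x, y, h1, h2, h3, h4, h5, h6, h7⟩ := hj' (by omega) (by omega)
              exact ⟨y, h2, h3, h5, h7⟩
          obtain ⟨y, hjy, hya, hy, hz⟩ := hy
          refine ⟨y + 2, by omega, by omega, by rw [join_mid (by omega)]; omega,
            fun z hz1 hz2 => ?_⟩
          obtain ⟨z, rfl⟩ := Nat.exists_eq_add_of_le' (show 2 ≤ z by omega)
          have := hz z (by omega) (by omega)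
          rw [join_mid (by omega)]
          omega
      obtain ⟨x, hx1, hx2, hx3⟩ := hL
      obtain ⟨y, hy1, hy2, hy3, hy4⟩ := hR
      exact ⟨x, y, hx1, hy1, by omega, hx2, hy3, hx3, hy4⟩
    · omega
    · obtain ⟨h1, x, y, hx, hy, hym, hfx, hfy, hl, hr⟩ := hg.up j hj (by omega)
      rw [join_right]
      refine ⟨h1, 4 * a + 4 + x, 4 * a + 4 + y, by omega, by omega, by omega,
        by rw [join_right, hfx], by rw [join_right, hfy], fun z hz hz' => ?_, fun z hz hz' => ?_⟩
      all_goals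
        obtain ⟨z, rfl⟩ := Nat.exists_eq_add_of_le (show 4 * a + 4 ≤ z by omega)
        rw [join_right]
      · exact hl z (by omega) (by omega)
      · exact hr z (by omega) (by omega)
  · intro k hk hk4
    rcases cases5 k hk with rfl | rfl | ⟨j, hj, rfl⟩ | rfl | ⟨j, hj, rfl⟩
    · exact ⟨by rw [join_zero]; omega, by omega⟩
    · omega
    · obtain ⟨h1, x, y, hx, hy, hym, hfx, hfy, hl, hr⟩ := hh.up j hj (by omega)
      have hjl := hh.le j hj
      have hyl := hh.le y hym
      rw [join_mid hj]
      refine ⟨by omega, fun _ _ => ⟨x + 2, y + 2, by omega, by omega, by omega, ?_, ?_,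
        fun z hz hz' => ?_, fun z hz hz' => ?_⟩⟩
      · rw [join_mid (by omega)]
        omega
      · rw [join_mid (by omega)]
        omega
      all_goals
        obtain ⟨z, rfl⟩ := Nat.exists_eq_add_of_le' (show 2 ≤ z by omega)
        rw [join_mid (by omega)]
      · have := hl z (by omega) (by omega)
        omega
      · have := hr z (by omega) (by omega)
        have := hh.le z (by omega)
        omega
    · omega
    · obtain ⟨hj4, hj'⟩ := hg.down j hj (by omega)
      have hjl := hg.le j hj
      rw [join_right]
      refine ⟨hj4, fun _ hjb => ?_⟩
      -- The first entry `4b` of the right summand has its upper neighbour `4b + 1` at position 1;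
      -- everything between them lies in the larger left block.
      by_cases hj0 : j = 0
      · subst hj0
        have h0 := hg.zero
        obtain ⟨y, hy, hy1⟩ := hg.surj (4 * b - 1) (by omega)
        have hy0 : y ≠ 0 := by
          rintro rfl
          omega
        refine ⟨1, 4 * a + 4 + y, by omega, by omega, by omega, by rw [join_one]; omega,
          by rw [join_right]; omega, fun z hz hz' => ?_, fun z hz hz' => ?_⟩
        · rcases cases5 z (by omega) with rfl | rfl | ⟨i, hi, rfl⟩ | rfl | ⟨i, hi, rfl⟩
          · omega
          · omega
          · rw [join_mid hi]
            have := hh.le i hi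
            omega
          · rw [join_last]
            omega
          · omega
        · obtain ⟨z, rfl⟩ := Nat.exists_eq_add_of_le (show 4 * a + 4 ≤ z by omega)
          rw [join_right]
          refine lt_of_le_of_ne (by rw [h0]; exact hg.le z (by omega)) fun he => ?_
          have := hg.inj (x := z) (y := 0) (by omega) (by omega) (by omega)
          omega
      · obtain ⟨x, y, hx, hy, hym, hfx, hfy, hl, hr⟩ := hj' (by omega) (by omega)
        refine ⟨4 * a + 4 + x, 4 * a + 4 + y, by omega, by omega, by omega,
          by rw [join_right, hfx], by rw [join_right, hfy], fun z hz hz' => ?_,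
          fun z hz hz' => ?_⟩
        all_goals
          obtain ⟨z, rfl⟩ := Nat.exists_eq_add_of_le (show 4 * a + 4 ≤ z by omega)
          rw [join_right]
        · exact hl z (by omega) (by omega)
        · exact hr z (by omega) (by omega)

/-! ### Splitting a leopard map. -/

theorem mod_four_of_apply (h : IsLeopardMap m f) {k : ℕ} (hk : k ≤ 4 * m)
    (hf : f k % 2 = 0) : k % 4 = f k % 4 := by
  rcases Nat.mod_two_eq_zero_or_one k with h0 | h1
  · by_cases h2 : k % 4 = 2
    · rw [(h.up k hk h2).1, h2]
    · have h3 : k % 4 = 0 := by omega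
      rw [(h.down k hk h3).1, h3]
  · have := h.odd k hk h1
    omega

/-- The positions up to the entry just below `f 1` carry exactly the entries from `f 1` on. -/
theorem exists_block (h : IsLeopardMap m f) (hm : 0 < m) :
    ∃ a b, a + b + 1 = m ∧ f 1 = 4 * b + 1 ∧ f (4 * a + 4) = 4 * b ∧
      (∀ z, 0 < z → z < 4 * a + 4 → 4 * b < f z) ∧
      ∀ z, 4 * a + 4 ≤ z → z ≤ 4 * m → f z ≤ 4 * b := by
  obtain ⟨h2, x, y, hx, hy, hym, hfx, hfy, -, -⟩ := h.up 2 (by omega) rfl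
  have h0 := h.zero
  have htop := h.top
  have h2l := h.le 2 (by omega)
  have hx1 : x = 1 := by
    rcases Nat.eq_zero_or_pos x with rfl | hpos <;> omega
  subst hx1
  obtain ⟨b, hb⟩ : ∃ b, f 1 = 4 * b + 1 := ⟨f 1 / 4, by omega⟩
  obtain ⟨p, hpm, hp⟩ := h.surj (4 * b) (by omega)
  have hp4 := h.mod_four_of_apply hpm (by omega)
  have hp0 : p ≠ 0 := by
    rintro rfl
    omega
  -- The upper neighbour of the entry `4b` is `f 1`, at position 1, so the `down` rule at `p` covers
  -- all positions strictly between 1 and `p`.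
  have hlow : ∀ z, 0 < z → z < p → 4 * b < f z := by
    intro z hz hzp
    by_cases hp' : p = 4 * m
    · rw [hp', htop] at hp
      have := h.inj (x := z) (y := 4 * m) (by omega) le_rfl
      omega
    · obtain ⟨x, y, hx, hy, hym, hfx, hfy, hl, hr⟩ :=
   (h.down p hpm (by omega)).2 (by omega) (by omega)
      have hx1 : x = 1 := h.inj (by omega) (by omega) (by omega)
      by_cases hz1 : z = 1
      · subst hz1
        omega
      · have := hl z (by omega) hzp
        omega
  obtain ⟨q, rfl⟩ : ∃ q, p = 4 * q + 4 := ⟨p / 4 - 1, by omega⟩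
  -- the entries at the positions `≡ 2` and `≡ 0` modulo `4` before `p`
  let A := (Finset.range (q + 1)).image (fun i => f (4 * i + 2) + 2)
  let B := (Finset.range q).image (fun i => f (4 * i + 4))
  have hA : A.card = q + 1 := by
    rw [Finset.card_image_of_injOn, Finset.card_range]
    intro i hi j hj hij
    simp only [Finset.coe_range, Set.mem_Iio] at hi hj
    have := h.inj (x := 4 * i + 2) (y := 4 * j + 2) (by omega) (by omega) (by simpa using hij)
    omega
  have hB : (insert (4 * m) B).card ≤ q + 1 :=
    (Finset.card_insert_le _ _).trans (by
      have := Finset.card_image_le (s := Finset.range q) (f := fun i => f (4 * i + 4))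
      rw [Finset.card_range] at this
      exact Nat.add_le_add_right this 1)
  -- For `v = f (4i + 2)`, the entry `v + 1` comes before `p`, since `4b < v` may not lie between
  -- them. The `down` rule for `v + 2` places it to the left of `v + 1`. Comparing cardinalities
  -- then gives equality.
  have hAB : A ⊆ insert (4 * m) B := by
    intro e he
    obtain ⟨i, hi, rfl⟩ := Finset.mem_image.1 he
    rw [Finset.mem_range] at hi
    obtain ⟨h1, x, y, hx, hy, hym, hfx, hfy, hl, hr⟩ := h.up (4 * i + 2) (by omega) (by omega)
    have hle := h.le (4 * i + 2) (by omega)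
    rw [Finset.mem_insert]
    by_cases hmax : f (4 * i + 2) + 2 = 4 * m
    · exact Or.inl hmax
    right
    obtain ⟨k, hk, hkv⟩ := h.surj (f (4 * i + 2) + 2) (by omega)
    have hk4 := h.mod_four_of_apply hk (by omega)
    have hyp : y < 4 * q + 4 := by
      by_contra hyp
      have hlow' := hlow (4 * i + 2) (by omega) (by omega)
      rcases (show 4 * q + 4 = y ∨ 4 * q + 4 < y by omega) with rfl | hlt
      · omega
      · have := hr (4 * q + 4) (by omega) hlt
        omega
    have hk0 : k ≠ 0 := by
      rintro rfl
      omega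
    have hkm : k ≠ 4 * m := by
      rintro rfl
      omega
    obtain ⟨x', y', hx', hy', hym', hfx', hfy', -, -⟩ :=
      (h.down k hk (by omega)).2 (by omega) (by omega)
    have hyy : y' = y := h.inj hym' hym (by omega)
    refine Finset.mem_image.2 ⟨k / 4 - 1, Finset.mem_range.2 (by omega), ?_⟩
    rw [show 4 * (k / 4 - 1) + 4 = k by omega, hkv]
  have hEq : A = insert (4 * m) B := Finset.eq_of_subset_of_card_le hAB (by omega)
  have hb1 := h.le 1 (by omega)
  -- Descent by 4 from the value `4m - 2`: if `v` sits before `p` at a position 2 modulo 4, then so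
  -- does `v - 1`, and `v - 2` cannot have `4b` between itself and `v - 1`. So `v - 2` lies in `B`,
  -- hence in `A`, which means that `v - 4` again sits before `p` at such a position.
  have hfull : ∀ j, 4 * b + 4 * j + 2 < 4 * m →
      ∃ i < q + 1, f (4 * i + 2) + 4 * j + 2 = 4 * m := by
    intro j
    induction j with
    | zero =>
      intro _
      have : 4 * m ∈ A := by
        rw [hEq]
        exact Finset.mem_insert_self _ _
      obtain ⟨i, hi, hi'⟩ := Finset.mem_image.1 this
      exact ⟨i, Finset.mem_range.1 hi, hi'⟩
    | succ j ih =>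
      intro hj
      obtain ⟨i, hi, hij⟩ := ih (by omega)
      obtain ⟨h1, x, y, hx, hy, hym, hfx, hfy, hl, hr⟩ := h.up (4 * i + 2) (by omega) (by omega)
      obtain ⟨k, hk, hkv⟩ := h.surj (f (4 * i + 2) - 2) (by omega)
      have hk4 := h.mod_four_of_apply hk (by omega)
      have hk0 : k ≠ 0 := by
        rintro rfl
        omega
      have hkm : k ≠ 4 * m := by
        rintro rfl
        omega
      obtain ⟨x', y', hx', hy', hym', hfx', hfy', hl', -⟩ :=
        (h.down k hk (by omega)).2 (by omega) (by omega)
      have hxx : x' = x := h.inj (by omega) (by omega) (by omega)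
      have hkq : k < 4 * q + 4 := by
        by_contra hkq
        rcases (show 4 * q + 4 = k ∨ 4 * q + 4 < k by omega) with rfl | hlt
        · omega
        · have := hl' (4 * q + 4) (by omega) hlt
          omega
      have : f k ∈ A := by
        rw [hEq]
        refine Finset.mem_insert_of_mem (Finset.mem_image.2 ⟨k / 4 - 1,
          Finset.mem_range.2 (by omega), ?_⟩)
        rw [show 4 * (k / 4 - 1) + 4 = k by omega]
      obtain ⟨i', hi', hi''⟩ := Finset.mem_image.1 this
      exact ⟨i', Finset.mem_range.1 hi', by omega⟩
  -- Values 2 modulo 4 are settled by `hfull`. Those 1 and 3 modulo 4 are their neighbours, and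
  -- those 0 modulo 4 lie in `A`, hence in `B`.
  have hcover : ∀ z, z ≤ 4 * m → 0 < z → 4 * b < f z → z < 4 * q + 4 := by
    intro z hzm hz0 hzb
    have hzl := h.le z hzm
    have hz4 : f z ≠ 4 * m := by
      intro he
      have := h.inj (x := z) (y := 0) hzm (by omega) (by omega)
      omega
    rcases (show f z % 4 = 2 ∨ f z % 4 = 1 ∨ f z % 4 = 3 ∨ f z % 4 = 0 by omega) with
      hc | hc | hc | hc
    · obtain ⟨i, hi, hij⟩ := hfull (m - (f z + 2) / 4) (by omega)
      have := h.inj (x := z) (y := 4 * i + 2) hzm (by omega) (by omega)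
      omega
    · obtain ⟨i, hi, hij⟩ := hfull (m - (f z + 3) / 4) (by omega)
      obtain ⟨h1, x, y, hx, hy, hym, hfx, hfy, hl, hr⟩ :=
        h.up (4 * i + 2) (by omega) (by omega)
      have := h.inj (x := z) (y := x) hzm (by omega) (by omega)
      omega
    · obtain ⟨i, hi, hij⟩ := hfull (m - (f z + 1) / 4) (by omega)
      obtain ⟨h1, x, y, hx, hy, hym, hfx, hfy, hl, hr⟩ :=
        h.up (4 * i + 2) (by omega) (by omega)
      have hzy := h.inj (x := z) (y := y) hzm (by omega) (by omega)
      subst hzy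
      by_contra hlt
      have hlow' := hlow (4 * i + 2) (by omega) (by omega)
      rcases (show 4 * q + 4 = z ∨ 4 * q + 4 < z by omega) with rfl | hlt
      · omega
      · have := hr (4 * q + 4) (by omega) hlt
        omega
    · obtain ⟨i, hi, hij⟩ := hfull (m - f z / 4) (by omega)
      have : f z ∈ A := Finset.mem_image.2 ⟨i, Finset.mem_range.2 hi, by omega⟩
      rw [hEq, Finset.mem_insert] at this
      rcases this with he | he
      · exact absurd he hz4
      · obtain ⟨i', hi', hi''⟩ := Finset.mem_image.1 he
        rw [Finset.mem_range] at hi'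
        have := h.inj (x := 4 * i' + 4) (y := z) (by omega) (by omega) hi''
        omega
  have hcard : 4 * q + 3 = 4 * m - 1 - 4 * b := by
    have himg : (Finset.Ioo 0 (4 * q + 4)).image f = Finset.Ioo (4 * b) (4 * m) := by
      ext v
      simp only [Finset.mem_image, Finset.mem_Ioo]
      constructor
      · rintro ⟨z, ⟨hz0, hzq⟩, rfl⟩
        refine ⟨hlow z hz0 hzq, lt_of_le_of_ne (h.le z (by omega)) fun he => ?_⟩
        have := h.inj (x := z) (y := 0) (by omega) (by omega) (by omega)
        omega
      · rintro ⟨hv, hv'⟩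
        obtain ⟨z, hz, rfl⟩ := h.surj v (by omega)
        have hz0 : z ≠ 0 := by
          rintro rfl
          omega
        exact ⟨z, ⟨by omega, hcover z hz (by omega) hv⟩, rfl⟩
    have hc := congrArg Finset.card himg
    rw [Finset.card_image_of_injOn, Nat.card_Ioo, Nat.card_Ioo] at hc
    · omega
    · intro i hi j hj hij
      simp only [Finset.coe_Ioo, Set.mem_Ioo] at hi hj
      exact h.inj (by omega) (by omega) hij
  refine ⟨q, b, by omega, hb, hp, hlow, fun z hz hzm => ?_⟩
  by_contra hlt
  have := hcover z hzm (by omega) (by omega)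
  omega

/-- The position `4a + 4` is shared: its entry `4b` is the closing 0 here and the opening maximum in
the right block. -/
theorem left_block {a b : ℕ} (h : IsLeopardMap (a + b + 1) f) (hp : f (4 * a + 4) = 4 * b)
    (hl : ∀ z, 0 < z → z < 4 * a + 4 → 4 * b < f z)
    (hr : ∀ z, 4 * a + 4 ≤ z → z ≤ 4 * (a + b + 1) → f z ≤ 4 * b) :
    IsLeopardMap (a + 1) (fun k => f k - 4 * b) where
  zero := by
    have := h.zero
    omega
  top := by
    rw [show 4 * (a + 1) = 4 * a + 4 by omega, hp]
    omega
  le k hk := by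
    have := h.le k (by omega)
    omega
  surj v hv := by
    obtain ⟨k, hk, hkv⟩ := h.surj (v + 4 * b) (by omega)
    by_cases hk' : k ≤ 4 * a + 4
    · exact ⟨k, by omega, by omega⟩
    · have := hr k (by omega) hk
      exact ⟨4 * a + 4, by omega, by omega⟩
  odd k hk hk2 := by
    have := h.odd k (by omega) hk2
    have := hl k (by omega) (by omega)
    omega
  up k hk hk4 := by
    obtain ⟨h1, x, y, hx, hy, hym, hfx, hfy, hlt, hgt⟩ := h.up k (by omega) hk4
    have hk' := hl k (by omega) (by omega)
    have hy' : y < 4 * a + 4 := by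
      by_contra hy'
      have := hr y (by omega) hym
      omega
    refine ⟨by omega, x, y, hx, hy, by omega, by omega, by omega, fun z hz hz' => ?_,
      fun z hz hz' => ?_⟩
    · have := hlt z hz hz'
      omega
    · have := hgt z hz hz'
      omega
  down k hk hk4 := by
    have hd := h.down k (by omega) hk4
    refine ⟨by omega, fun hk0 hkm => ?_⟩
    obtain ⟨x, y, hx, hy, hym, hfx, hfy, hlt, hgt⟩ := hd.2 hk0 (by omega)
    have hk' := hl k (by omega) (by omega)
    have hy' : y < 4 * a + 4 := by
      by_contra hy'
      have := hr y (by omega) hym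
      omega
    refine ⟨x, y, hx, hy, by omega, by omega, by omega, fun z hz hz' => ?_, fun z hz hz' => ?_⟩
    · have := hlt z hz hz'
      omega
    · have := hgt z hz hz'
      omega

theorem right_block {a b : ℕ} (h : IsLeopardMap (a + b + 1) f) (hp : f (4 * a + 4) = 4 * b)
    (hl : ∀ z, 0 < z → z < 4 * a + 4 → 4 * b < f z)
    (hr : ∀ z, 4 * a + 4 ≤ z → z ≤ 4 * (a + b + 1) → f z ≤ 4 * b) :
    IsLeopardMap b (fun k => f (4 * a + 4 + k)) := by
  have h0 := h.zero
  have key : ∀ x, f x ≤ 4 * b → 4 * a + 4 ≤ x := by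
    intro x hx
    by_contra hx'
    rcases Nat.eq_zero_or_pos x with rfl | hpos
    · omega
    · have := hl x hpos (by omega)
      omega
  constructor
  · exact hp
  · rw [show 4 * a + 4 + 4 * b = 4 * (a + b + 1) by omega]
    exact h.top
  · intro k hk
    exact hr _ (by omega) (by omega)
  · intro v hv
    obtain ⟨k, hk, hkv⟩ := h.surj v (by omega)
    have := key k (by omega)
    exact ⟨k - (4 * a + 4), by omega, by rw [show 4 * a + 4 + (k - (4 * a + 4)) = k by omega, hkv]⟩
  · intro k hk hk2
    exact h.odd _ (by omega) (by omega)
  · intro k hk hk4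
    obtain ⟨h1, x, y, hx, hy, hym, hfx, hfy, hlt, hgt⟩ := h.up (4 * a + 4 + k) (by omega) (by omega)
    have hk' := hr (4 * a + 4 + k) (by omega) (by omega)
    obtain ⟨x, rfl⟩ := Nat.exists_eq_add_of_le (key x (by omega))
    obtain ⟨y, rfl⟩ := Nat.exists_eq_add_of_le (show 4 * a + 4 ≤ y by omega)
    exact ⟨h1, x, y, by omega, by omega, by omega, hfx, hfy,
      fun z hz hz' => hlt _ (by omega) (by omega), fun z hz hz' => hgt _ (by omega) (by omega)⟩
  · intro k hk hk4
    have hd := h.down (4 * a + 4 + k) (by omega) (by omega)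
    refine ⟨hd.1, fun hk0 hkm => ?_⟩
    obtain ⟨x, y, hx, hy, hym, hfx, hfy, hlt, hgt⟩ := hd.2 (by omega) (by omega)
    have hk' := hr (4 * a + 4 + k) (by omega) (by omega)
    have hne : f (4 * a + 4 + k) ≠ 4 * b := by
      intro he
      have := h.inj (x := 4 * a + 4 + k) (y := 4 * a + 4) (by omega) (by omega) (by omega)
      omega
    obtain ⟨x, rfl⟩ := Nat.exists_eq_add_of_le (key x (by omega))
    obtain ⟨y, rfl⟩ := Nat.exists_eq_add_of_le (show 4 * a + 4 ≤ y by omega)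
    exact ⟨x, y, by omega, by omega, by omega, hfx, hfy,
      fun z hz hz' => hlt _ (by omega) (by omega), fun z hz hz' => hgt _ (by omega) (by omega)⟩

/-- A map that fixes the first entry also fixes the last one. -/
theorem last_of_first {a : ℕ} (h : IsLeopardMap (a + 1) f) (h1 : f 1 = 1) :
    f (4 * a + 3) = 4 * a + 3 := by
  -- The first entry of the reverse complement encodes `f (4a + 3)`. If its right block were
  -- nontrivial, that block would contain position `4a + 3`, whose entry `4a + 3` exceeds the bound
  -- `4b' ≤ 4a`.
  obtain ⟨a', b', hab, hb1, hp, hl, hr⟩ := h.reverse_compl.exists_block (by omega)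
  have hle := h.le (4 * a + 3) (by omega)
  rw [show 4 * (a + 1) - 1 = 4 * a + 3 by omega] at hb1
  by_cases hb0 : b' = 0
  · omega
  · have := hr (4 * a + 3) (by omega) (by omega)
    rw [show 4 * (a + 1) - (4 * a + 3) = 1 by omega, h1] at this
    omega

theorem middle_bounds {a : ℕ} (h : IsLeopardMap (a + 1) f) (h1 : f 1 = 1) {k : ℕ}
    (hk : k ≤ 4 * a) : 2 ≤ f (k + 2) ∧ f (k + 2) ≤ 4 * a + 2 := by
  have h0 := h.zero
  have htop := h.top
  rw [show 4 * (a + 1) = 4 * a + 4 by omega] at h0 htop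
  have hlast := h.last_of_first h1
  have hle := h.le (k + 2) (by omega)
  have e0 : f (k + 2) ≠ f 0 := fun he => by
    have := h.inj (x := k + 2) (y := 0) (by omega) (by omega) he
    omega
  have e1 : f (k + 2) ≠ f 1 := fun he => by
    have := h.inj (x := k + 2) (y := 1) (by omega) (by omega) he
    omega
  have e2 : f (k + 2) ≠ f (4 * a + 3) := fun he => by
    have := h.inj (x := k + 2) (y := 4 * a + 3) (by omega) (by omega) he
    omega
  have e3 : f (k + 2) ≠ f (4 * a + 4) := fun he => by
    have := h.inj (x := k + 2) (y := 4 * a + 4) (by omega) (by omega) he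
    omega
  omega

/-- The positions `0`, `1`, `4a + 3`, `4a + 4` carry exactly the extreme values, so neighbours of
inner entries stay inside. The shift by 2 and the complement exchange `up` and `down`, as in the
join. -/
theorem middle {a : ℕ} (h : IsLeopardMap (a + 1) f) (h1 : f 1 = 1) :
    IsLeopardMap a (fun k => 4 * a + 2 - f (k + 2)) := by
  have h0 := h.zero
  have htop := h.top
  rw [show 4 * (a + 1) = 4 * a + 4 by omega] at h0 htop
  have hlast := h.last_of_first h1
  have hmid := fun k hk => h.middle_bounds h1 (k := k) hk
  have key : ∀ x ≤ 4 * (a + 1), 2 ≤ f x → f x ≤ 4 * a + 2 → ∃ k ≤ 4 * a, x = k + 2 := by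
    intro x hx hx1 hx2
    have e0 : x ≠ 0 := by
      rintro rfl
      omega
    have e1 : x ≠ 1 := by
      rintro rfl
      omega
    have e2 : x ≠ 4 * a + 3 := by
      rintro rfl
      omega
    have e3 : x ≠ 4 * a + 4 := by
      rintro rfl
      omega
    exact ⟨x - 2, by omega, by omega⟩
  have hf2 : f 2 = 2 := by
    obtain ⟨-, x, y, hx, hy, hym, hfx, hfy, -, -⟩ := h.up 2 (by omega) rfl
    have h2 := hmid 0 (by omega)
    have : x = 1 := by
      by_contra hx1
      have hx0 : x = 0 := by omega
      subst hx0
      simp only [Nat.zero_add] at h2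
      omega
    subst this
    omega
  have hf2' : f (4 * a + 2) = 4 * a + 2 := by
    obtain ⟨h4, x, y, hx, hy, hym, hfx, hfy, -, -⟩ := h.up (4 * a + 2) (by omega) (by omega)
    have : y = 4 * a + 3 := by
      by_contra hy1
      have : y = 4 * a + 4 := by omega
      subst this
      omega
    subst this
    omega
  constructor
  · simp only [Nat.zero_add]
    omega
  · omega
  · intro k hk
    have := hmid k hk
    omega
  · intro v hv
    obtain ⟨k, hk, hkv⟩ := h.surj (4 * a + 2 - v) (by omega)
    obtain ⟨j, hj, rfl⟩ := key k hk (by omega) (by omega)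
    exact ⟨j, hj, by omega⟩
  · intro k hk hk2
    have := hmid k hk
    have := h.odd (k + 2) (by omega) (by omega)
    omega
  · intro k hk hk4
    obtain ⟨h4, h4'⟩ := h.down (k + 2) (by omega) (by omega)
    obtain ⟨x, y, hx, hy, hym, hfx, hfy, hlt, hgt⟩ := h4' (by omega) (by omega)
    have hk' := hmid k hk
    obtain ⟨x, hx', rfl⟩ := key x (by omega) (by omega) (by omega)
    obtain ⟨y, hy', rfl⟩ := key y (by omega) (by omega) (by omega)
    clear h4'
    refine ⟨by omega, x, y, by omega, by omega, by omega, by omega, by omega,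
      fun z hz hz' => ?_, fun z hz hz' => ?_⟩
    · have := hlt (z + 2) (by omega) (by omega)
      omega
    · have := hgt (z + 2) (by omega) (by omega)
      omega
  · intro k hk hk4
    obtain ⟨h4, x, y, hx, hy, hym, hfx, hfy, hlt, hgt⟩ := h.up (k + 2) (by omega) (by omega)
    have hk' := hmid k hk
    refine ⟨by omega, fun hk0 hkm => ?_⟩
    have e1 : f (k + 2) ≠ f 2 := fun he => by
      have := h.inj (x := k + 2) (y := 2) (by omega) (by omega) he
      omega
    have e2 : f (k + 2) ≠ f (4 * a + 2) := fun he => by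
      have := h.inj (x := k + 2) (y := 4 * a + 2) (by omega) (by omega) he
      omega
    obtain ⟨x, hx', rfl⟩ := key x (by omega) (by omega) (by omega)
    obtain ⟨y, hy', rfl⟩ := key y (by omega) (by omega) (by omega)
    refine ⟨x, y, by omega, by omega, by omega, by omega, by omega,
      fun z hz hz' => ?_, fun z hz hz' => ?_⟩
    · have := hlt (z + 2) (by omega) (by omega)
      omega
    · have := hgt (z + 2) (by omega) (by omega)
      have := hmid z (by omega)
      omega

theorem exists_join (h : IsLeopardMap m f) (hm : 0 < m) :
    ∃ a b h' g, a + b + 1 = m ∧ IsLeopardMap a h' ∧ IsLeopardMap b g ∧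
      ∀ k ≤ 4 * m, f k = join a b h' g k := by
  obtain ⟨a, b, rfl, h1, hp, hl, hr⟩ := h.exists_block hm
  have hL := h.left_block hp hl hr
  have hL1 : f 1 - 4 * b = 1 := by omega
  have hlast := hL.last_of_first hL1
  refine ⟨a, b, _, _, rfl, hL.middle hL1, h.right_block hp hl hr, fun k hk => ?_⟩
  by_cases hk0 : k = 0
  · subst hk0
    exact h.zero
  by_cases hk1 : k = 1
  · subst hk1
    exact h1
  by_cases hk2 : k ≤ 4 * a + 2
  · obtain ⟨k, rfl⟩ := Nat.exists_eq_add_of_le' (show 2 ≤ k by omega)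
    rw [join_mid (by omega)]
    have := hL.middle_bounds hL1 (k := k) (by omega)
    omega
  by_cases hk3 : k = 4 * a + 3
  · subst hk3
    rw [join_last]
    omega
  · obtain ⟨k, rfl⟩ := Nat.exists_eq_add_of_le (show 4 * a + 4 ≤ k by omega)
    rw [join_right]

end IsLeopardMap

/-! ### The even and odd threads of such a map -/

/-- The word `1 ⊖ e` for the even thread `e` that is induced by `f`. -/
def evenThreadWord (m : ℕ) (f : ℕ → ℕ) : List ℕ := (List.range m).map (fun s => f (4 * s) / 4)

/-- The odd thread that is induced by `f`. -/
def oddThreadWord (m : ℕ) (f : ℕ → ℕ) : List ℕ :=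
  (List.range m).map (fun s => (f (4 * s + 2) + 2) / 4)

theorem evenThreadWord_congr {m : ℕ} {f g : ℕ → ℕ} (h : ∀ k ≤ 4 * m, f k = g k) :
    evenThreadWord m f = evenThreadWord m g := by
  apply List.map_congr_left
  intro s hs
  rw [List.mem_range] at hs
  rw [h _ (by omega)]

theorem oddThreadWord_congr {m : ℕ} {f g : ℕ → ℕ} (h : ∀ k ≤ 4 * m, f k = g k) :
    oddThreadWord m f = oddThreadWord m g := by
  apply List.map_congr_left
  intro s hs
  rw [List.mem_range] at hs
  rw [h _ (by omega)]

open IsLeopardMap in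
-- Since `h` is shifted by 2, positions 0 modulo 4 of the join read positions 2 modulo 4 of `h`;
-- this is why the even rule calls on an odd thread.
theorem evenThreadWord_join {a b : ℕ} {h g : ℕ → ℕ} (hh : IsLeopardMap a h) :
    evenThreadWord (a + b + 1) (join a b h g) = skewSumWord [1]
      (skewSumWord (complWord (oddThreadWord a h)) (evenThreadWord b g)) := by
  rw [evenThreadWord, show a + b + 1 = 1 + (a + b) by omega, List.range_add, List.range_add]
  simp only [skewSumWord, complWord, evenThreadWord, oddThreadWord, List.map_append, List.map_map,
    List.length_append, List.length_map, List.length_range, List.map_cons, List.map_nil,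
    List.range_one]
  congr 1
  · simp only [Nat.mul_zero, join_zero]
    congr 1
    omega
  · congr 1 <;> apply List.map_congr_left <;> intro s hs <;> rw [List.mem_range] at hs <;>
      simp only [Function.comp]
    · rw [show 4 * (1 + s) = (4 * s + 2) + 2 by omega, join_mid (by omega)]
      have := (hh.up (4 * s + 2) (by omega) (by omega)).1
      have := hh.le (4 * s + 2) (by omega)
      omega
    · rw [show 4 * (1 + (a + s)) = 4 * a + 4 + 4 * s by omega, join_right]

open IsLeopardMap in
theorem oddThreadWord_join {a b : ℕ} {h g : ℕ → ℕ} (hh : IsLeopardMap a h) :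
    oddThreadWord (a + b + 1) (join a b h g) = skewSumWord
      (directSumWord (complWord (evenThreadWord a h)) [1]) (oddThreadWord b g) := by
  rw [oddThreadWord, show a + b + 1 = (a + 1) + b by omega, List.range_add, List.range_add]
  simp only [skewSumWord, directSumWord, complWord, evenThreadWord, oddThreadWord,
    List.map_append, List.map_map, List.length_map, List.length_range, List.map_cons,
    List.map_nil, List.range_one]
  congr 1
  · congr 1
    · apply List.map_congr_left
      intro s hs
      rw [List.mem_range] at hs
      simp only [Function.comp]
      rw [join_mid (by omega)]
      have := (hh.down (4 * s) (by omega) (by omega)).1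
      have := hh.le (4 * s) (by omega)
      omega
    · rw [show 4 * (a + 0) + 2 = 4 * a + 2 from rfl, join_mid le_rfl, hh.top]
      congr 1
      omega
  · apply List.map_congr_left
    intro s hs
    simp only [Function.comp]
    rw [show 4 * (a + 1 + s) + 2 = 4 * a + 4 + (4 * s + 2) by omega, join_right]

theorem IsLeopardMap.thread {m : ℕ} {f : ℕ → ℕ} (h : IsLeopardMap m f) :
    Thread true (evenThreadWord m f) ∧ Thread false (oddThreadWord m f) := by
  induction m using Nat.strong_induction_on generalizing f with
  | _ m ih =>
    rcases Nat.eq_zero_or_pos m with rfl | hm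
    · exact ⟨Thread.nil _, Thread.nil _⟩
    · obtain ⟨a, b, h', g, rfl, ha, hb, hf⟩ := h.exists_join hm
      rw [evenThreadWord_congr hf, oddThreadWord_congr hf, evenThreadWord_join ha,
        oddThreadWord_join ha]
      obtain ⟨h1, h2⟩ := ih a (by omega) ha
      obtain ⟨h3, h4⟩ := ih b (by omega) hb
      exact ⟨Thread.even h2 h3, Thread.odd h1 h4⟩

theorem Thread.exists_isLeopardMap {b : Bool} {w : List ℕ} (h : Thread b w) :
    ∃ m f, IsLeopardMap m f ∧ w = bif b then evenThreadWord m f else oddThreadWord m f := by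
  induction h with
  | nil b => exact ⟨0, _, IsLeopardMap.isLeopardMap_zero, by cases b <;> rfl⟩
  | even _ _ iho ihe =>
    obtain ⟨a, h, hh, rfl⟩ := iho
    obtain ⟨b, g, hg, rfl⟩ := ihe
    exact ⟨_, _, IsLeopardMap.isLeopardMap_join hh hg, (evenThreadWord_join hh).symm⟩
  | odd _ _ ihe iho =>
    obtain ⟨a, h, hh, rfl⟩ := ihe
    obtain ⟨b, g, hg, rfl⟩ := iho
    exact ⟨_, _, IsLeopardMap.isLeopardMap_join hh hg, (oddThreadWord_join hh).symm⟩

/-! ### From words to maps and back -/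

theorem entry_map_range {n k : ℕ} (g : ℕ → ℕ) (hk : 1 ≤ k) (hkn : k ≤ n) :
    entry ((List.range n).map g) k = g (k - 1) := by
  have : k - 1 < n := by omega
  simp [entry, List.getD, this]

theorem eq_map_range_entry (w : List ℕ) :
    w = (List.range w.length).map (fun i => entry w (i + 1)) := by
  apply List.ext_getElem
  · simp
  · intro i h1 h2
    simp [entry, List.getD, h1]

theorem evenWord_map_range {n : ℕ} {g : ℕ → ℕ} (hg : ∀ i < n, g i % 2 = (i + 1) % 2) :
    evenWord ((List.range n).map g) = (List.range (n / 2)).map (fun i => g (2 * i + 1) / 2) := by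
  induction n with
  | zero => rfl
  | succ n ih =>
    have ih' := ih fun i hi => hg i (by omega)
    have hn := hg n (by omega)
    rw [evenWord] at ih' ⊢
    rw [List.range_succ, List.map_append, List.filter_append, List.map_append, ih']
    rcases Nat.mod_two_eq_zero_or_one n with h | h
    · rw [show (n + 1) / 2 = n / 2 by omega]
      have : g n % 2 = 1 := by omega
      simp [this]
    · rw [show (n + 1) / 2 = n / 2 + 1 by omega, List.range_succ, List.map_append]
      have : g n % 2 = 0 := by omega
      simp [this, show 2 * (n / 2) + 1 = n by omega]

theorem oddWord_map_range {n : ℕ} {g : ℕ → ℕ} (hg : ∀ i < n, g i % 2 = (i + 1) % 2) :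
    oddWord ((List.range n).map g) =
      (List.range ((n + 1) / 2)).map (fun i => (g (2 * i) + 1) / 2) := by
  induction n with
  | zero => rfl
  | succ n ih =>
    have ih' := ih fun i hi => hg i (by omega)
    have hn := hg n (by omega)
    rw [oddWord] at ih' ⊢
    rw [List.range_succ, List.map_append, List.filter_append, List.map_append, ih']
    rcases Nat.mod_two_eq_zero_or_one n with h | h
    · rw [show (n + 1 + 1) / 2 = (n + 1) / 2 + 1 by omega, List.range_succ, List.map_append]
      have : g n % 2 = 1 := by omega
      simp [this, show 2 * ((n + 1) / 2) = n by omega]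
    · rw [show (n + 1 + 1) / 2 = (n + 1) / 2 by omega]
      have : g n % 2 = 0 := by omega
      simp [this]

theorem entry_inverse_map_range {n i : ℕ} {g : ℕ → ℕ}
    (hg : ∀ i < n, ∀ j < n, g i = g j → i = j) (hi : i < n) (h1 : 1 ≤ g i) (hn : g i ≤ n) :
    entry (inverse ((List.range n).map g)) (g i) = i + 1 := by
  have hlt : g i - 1 < n := by omega
  have hmem : g i ∈ (List.range n).map g := List.mem_map_of_mem (List.mem_range.2 hi)
  have hidx := List.idxOf_lt_length_of_mem hmem
  have hget := List.getElem_idxOf hidx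
  rw [List.getElem_map, List.getElem_range] at hget
  rw [List.length_map, List.length_range] at hidx
  have := hg _ hidx _ hi hget
  simp [entry, inverse, List.getD, hlt, show 1 + (g i - 1) = g i by omega, this]

theorem IsPermutation.mem_iff {w : List ℕ} (h : IsPermutation w) {x : ℕ} :
    x ∈ w ↔ 1 ≤ x ∧ x ≤ w.length := by
  rw [List.Perm.mem_iff h, List.mem_range'_1]
  omega

theorem IsPermutation.entry_bounds {w : List ℕ} (h : IsPermutation w) {k : ℕ} (hk : 1 ≤ k)
    (hkw : k ≤ w.length) : 1 ≤ entry w k ∧ entry w k ≤ w.length := by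
  rw [← h.mem_iff, entry, List.getD, List.getElem?_eq_getElem (by omega)]
  exact List.getElem_mem _

theorem IsPermutation.exists_entry_eq {w : List ℕ} (h : IsPermutation w) {v : ℕ} (hv : 1 ≤ v)
    (hvw : v ≤ w.length) : ∃ k, 1 ≤ k ∧ k ≤ w.length ∧ entry w k = v := by
  obtain ⟨i, hi, rfl⟩ := List.getElem_of_mem (h.mem_iff.2 ⟨hv, hvw⟩)
  exact ⟨i + 1, by omega, by omega, by simp [entry, List.getD, hi]⟩

theorem isPermutation_map_range {n : ℕ} {g : ℕ → ℕ}
    (hg : ∀ i < n, ∀ j < n, g i = g j → i = j) (hb : ∀ i < n, 1 ≤ g i ∧ g i ≤ n) :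
    IsPermutation ((List.range n).map g) := by
  have hnd : ((List.range n).map g).Nodup := by
    refine List.Nodup.map_on ?_ List.nodup_range
    intro x hx y hy
    exact hg x (List.mem_range.1 hx) y (List.mem_range.1 hy)
  rw [IsPermutation, List.length_map, List.length_range]
  refine (List.subperm_of_subset hnd ?_).perm_of_length_le (by simp)
  intro x hx
  obtain ⟨i, hi, rfl⟩ := List.mem_map.1 hx
  have := hb i (List.mem_range.1 hi)
  rw [List.mem_range'_1]
  omega

/-- At an even position of a complete Baxter permutation, the odd part ascends if and only if the
inverse of the odd part ascends at the corresponding value. -/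
theorem IsCompleteBaxter.around {w : List ℕ} (h : IsCompleteBaxter w) {k x y : ℕ} (hk : 1 < k)
    (hkw : k < w.length) (hk2 : Even k) (hx : 1 ≤ x) (hxw : x ≤ w.length) (hy : 1 ≤ y)
    (hyw : y ≤ w.length) (hfx : entry w x + 1 = entry w k) (hfy : entry w y = entry w k + 1) :
    (entry w (k - 1) < entry w (k + 1) ∧ x < k ∧ k < y ∨
      entry w (k + 1) < entry w (k - 1) ∧ y < k ∧ k < x) ∧
    (∀ z, (x < z ∧ z < k ∨ k < z ∧ z < x) → entry w z < entry w k) ∧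
    ∀ z, (k < z ∧ z < y ∨ y < z ∧ z < k) → entry w k < entry w z := by
  obtain ⟨-, -, hpar, hb⟩ := h
  have he := (hpar k (by omega) (by omega)).2 hk2
  have ho : Odd (entry w x) := by
    rw [← Nat.not_even_iff_odd]
    intro hxe
    rw [← hfx] at he
    exact (Nat.even_add_one.1 he) hxe
  have h1 : ∀ z, (x < z ∧ z < k ∨ k < z ∧ z < x) → entry w z + 1 < entry w k := by
    intro z hz
    have := (hb (entry w x) x k z hx hxw (by omega) (by omega) rfl hfx.symm hz).1 ho
    omega
  have h2 : ∀ z, (k < z ∧ z < y ∨ y < z ∧ z < k) → entry w k + 1 < entry w z := fun z hz =>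
    (hb (entry w k) k y z (by omega) (by omega) hy hyw rfl hfy hz).2 he
  refine ⟨?_, fun z hz => by have := h1 z hz; omega, fun z hz => by have := h2 z hz; omega⟩
  have hxk : x ≠ k := by
    rintro rfl
    omega
  have hyk : y ≠ k := by
    rintro rfl
    omega
  have hxy : x ≠ y := by
    rintro rfl
    omega
  -- If `x` and `y` were on the same side of `k`, the entry adjacent to `k` on that side would be
  -- both below and above `w(k)`. With opposite sides, the two adjacent entries straddle `w(k)` in
  -- the stated order; `b1` to `b4` treat adjacency to `x` or `y` itself.
  have a1 := h1 (k - 1)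
  have a2 := h1 (k + 1)
  have a3 := h2 (k - 1)
  have a4 := h2 (k + 1)
  have b1 : x = k - 1 → entry w (k - 1) + 1 = entry w k := fun e => by rw [← e, hfx]
  have b2 : x = k + 1 → entry w (k + 1) + 1 = entry w k := fun e => by rw [← e, hfx]
  have b3 : y = k - 1 → entry w (k - 1) = entry w k + 1 := fun e => by rw [← e, hfy]
  have b4 : y = k + 1 → entry w (k + 1) = entry w k + 1 := fun e => by rw [← e, hfy]
  omega

theorem exists_isLeopardMap_of_isSnowLeopardWord {v : List ℕ} (h : IsSnowLeopardWord v)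
    (hv : Odd v.length) : ∃ m f, IsLeopardMap m f ∧ 0 < m ∧
      v = (List.range (2 * m - 1)).map (fun i => f (2 * i + 2) / 2) := by
  obtain ⟨-, u, -, ⟨halt, hinv⟩, w, hw, rfl, rfl⟩ := h
  have hw' := hw
  obtain ⟨hperm, hN, hpar, -⟩ := hw'
  have hpar2 : ∀ k, 1 ≤ k → k ≤ w.length → entry w k % 2 = k % 2 := by
    intro k hk hkw
    have := hpar k hk hkw
    rw [Nat.even_iff, Nat.even_iff] at this
    omega
  have hev := evenWord_map_range (n := w.length) (g := fun i => entry w (i + 1))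
    (fun i hi => hpar2 _ (by omega) (by omega))
  have hod := oddWord_map_range (n := w.length) (g := fun i => entry w (i + 1))
    (fun i hi => hpar2 _ (by omega) (by omega))
  rw [← eq_map_range_entry] at hev hod
  rw [hev, List.length_map, List.length_range, Nat.odd_iff] at hv
  rw [Nat.odd_iff] at hN
  -- Both `w.length` and its half, rounded down, are odd, so `w.length` is 3 modulo 4.
  obtain ⟨m, hm⟩ : ∃ m, w.length + 1 = 4 * m := ⟨(w.length + 1) / 4, by omega⟩
  rw [show (w.length + 1) / 2 = 2 * m by omega] at hod
  rw [show w.length / 2 = 2 * m - 1 by omega] at hev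
  have hsurj : ∀ v, 1 ≤ v → v < 4 * m → ∃ k, 1 ≤ k ∧ k ≤ w.length ∧ entry w k = v :=
    fun v hv hv' => hperm.exists_entry_eq hv (by omega)
  have hbd : ∀ k, 1 ≤ k → k < 4 * m → 1 ≤ entry w k ∧ entry w k < 4 * m := by
    intro k hk hkm
    have := hperm.entry_bounds hk (by omega)
    omega
  have hinj : ∀ x y, 1 ≤ x → x < 4 * m → 1 ≤ y → y < 4 * m → entry w x = entry w y → x = y := by
    intro x y hx hxm hy hym hxy
    have hnd : w.Nodup := (List.Perm.nodup_iff hperm).2 List.nodup_range'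
    have := (List.Nodup.getElem_inj_iff hnd (i := x - 1) (hi := by omega) (j := y - 1)
      (hj := by omega)).1 (by
        simpa [entry, List.getD, show x - 1 < w.length by omega,
          show y - 1 < w.length by omega] using hxy)
    omega
  have halt' : ∀ s, 1 ≤ s → s + 1 ≤ 2 * m →
      (s % 2 = 1 → entry w (2 * s - 1) < entry w (2 * s + 1)) ∧
      (s % 2 = 0 → entry w (2 * s + 1) < entry w (2 * s - 1)) := by
    intro s hs hsm
    have := halt s hs (by rw [hod]; simpa using hsm)
    rw [hod, entry_map_range _ hs (by omega), entry_map_range _ (by omega) hsm, Nat.odd_iff,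
      Nat.even_iff] at this
    rw [show 2 * (s - 1) + 1 = 2 * s - 1 by omega, show 2 * (s + 1 - 1) + 1 = 2 * s + 1 by omega]
      at this
    exact ⟨fun h => by have := this.1 h; omega, fun h => by have := this.2 h; omega⟩
  have hent : ∀ x, 1 ≤ x → x < 4 * m → x % 2 = 1 →
      entry (inverse (oddWord w)) ((entry w x + 1) / 2) = (x + 1) / 2 := by
    intro x hx hxm hx2
    have hbx := hbd x hx hxm
    have := entry_inverse_map_range (n := 2 * m) (i := x / 2)
      (g := fun i => (entry w (2 * i + 1) + 1) / 2) (fun i hi j hj hij => ?_) (by omega)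
    · rw [show 2 * (x / 2) + 1 = x by omega] at this
      rw [hod, this (by omega) (by omega)]
      omega
    · have h1 := hpar2 (2 * i + 1) (by omega) (by omega)
      have h2 := hpar2 (2 * j + 1) (by omega) (by omega)
      have := hinj (2 * i + 1) (2 * j + 1) (by omega) (by omega) (by omega) (by omega) (by omega)
      omega
  have hinv' : ∀ x y t, 1 ≤ x → x < 4 * m → 1 ≤ y → y < 4 * m → entry w x + 1 = 2 * t →
      entry w y = 2 * t + 1 → (x < y ↔ t % 2 = 1) := by
    intro x y t hx hxm hy hym hfx hfy
    have h1 := hpar2 x hx (by omega)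
    have h2 := hpar2 y hy (by omega)
    have h3 := hent x hx hxm (by omega)
    have h4 := hent y hy hym (by omega)
    have hby := hbd y hy hym
    have := hinv t (by omega) (by simp [inverse, hod]; omega)
    rw [show (entry w x + 1) / 2 = t by omega] at h3
    rw [show (entry w y + 1) / 2 = t + 1 by omega] at h4
    rw [h3, h4, Nat.odd_iff, Nat.even_iff] at this
    have hxy : x ≠ y := by
      rintro rfl
      omega
    omega
  -- The parity of `k / 2` decides whether the odd part ascends at `k`, that of `w(k) / 2` whether
  -- its inverse ascends. As these ascents coincide, `w(k) ≡ k` modulo 4.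
  have hrule : ∀ k, 1 ≤ k → k < 4 * m → k % 2 = 0 → ∃ x y, 1 ≤ x ∧ x < 4 * m ∧ 1 ≤ y ∧ y < 4 * m ∧
      entry w x + 1 = entry w k ∧ entry w y = entry w k + 1 ∧ entry w k % 4 = k % 4 ∧
      (k % 4 = 2 ∧ x < k ∧ k < y ∨ k % 4 = 0 ∧ y < k ∧ k < x) ∧
      (∀ z, (x < z ∧ z < k ∨ k < z ∧ z < x) → entry w z < entry w k) ∧
      ∀ z, (k < z ∧ z < y ∨ y < z ∧ z < k) → entry w k < entry w z := by
    intro k hk hkm hk2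
    have hbk := hbd k hk hkm
    have hpk := hpar2 k hk (by omega)
    obtain ⟨x, hx, hxw, hfx⟩ := hsurj (entry w k - 1) (by omega) (by omega)
    obtain ⟨y, hy, hyw, hfy⟩ := hsurj (entry w k + 1) (by omega) (by omega)
    obtain ⟨h1, h2, h3⟩ := hw.around (k := k) (by omega) (by omega) (Nat.even_iff.2 hk2) hx hxw hy
      hyw (by omega) hfy
    have h4 := halt' (k / 2) (by omega) (by omega)
    rw [show 2 * (k / 2) = k by omega] at h4
    have h5 := hinv' x y (entry w k / 2) hx (by omega) hy (by omega) (by omega) (by omega)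
    exact ⟨x, y, hx, by omega, hy, by omega, by omega, hfy, by omega, by omega, h2, h3⟩
  have hf : ∀ k, 1 ≤ k → (if k = 0 then 4 * m else entry w k) = entry w k := by
    intro k hk
    rw [if_neg (by omega)]
  -- Position `4m` is just past the end of `w`; the default value 0 of `entry` is the required
  -- boundary value.
  have htop : entry w (4 * m) = 0 := by
    simp [entry, List.getD, show w.length ≤ 4 * m - 1 by omega]
  refine ⟨m, fun k => if k = 0 then 4 * m else entry w k, ?_, by omega, ?_⟩
  · constructor
    · rfl
    · rw [hf _ (by omega), htop]
    · intro k hk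
      by_cases hk0 : k = 0
      · simp [hk0]
      · rw [hf _ (by omega)]
        by_cases hkm : k = 4 * m
        · rw [hkm, htop]
          omega
        · exact (hbd k (by omega) (by omega)).2.le
    · intro v hv
      by_cases hv0 : v = 0
      · exact ⟨4 * m, le_rfl, by rw [hf _ (by omega), htop, hv0]⟩
      · by_cases hvm : v = 4 * m
        · exact ⟨0, by omega, by simp [hvm]⟩
        · obtain ⟨k, hk, hkw, hkv⟩ := hsurj v (by omega) (by omega)
          exact ⟨k, by omega, by rw [hf _ hk, hkv]⟩
    · intro k hk hk2
      rw [hf _ (by omega), hpar2 k (by omega) (by omega), hk2]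
    · intro k hk hk4
      obtain ⟨x, y, hx, hxm, hy, hym, hfx, hfy, h4, hord, hlt, hgt⟩ :=
        hrule k (by omega) (by omega) (by omega)
      rw [hf k (by omega)]
      refine ⟨by omega, x, y, by omega, by omega, by omega, by rw [hf x hx, hfx],
        by rw [hf y hy, hfy], fun z hz hz' => ?_, fun z hz hz' => ?_⟩
      · rw [hf z (by omega)]
        exact hlt z (by omega)
      · rw [hf z (by omega)]
        exact hgt z (by omega)
    · intro k hk hk4
      by_cases hk0 : k = 0
      · subst hk0
        exact ⟨by simp, by omega⟩
      · rw [hf k (by omega)]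
        by_cases hkm : k = 4 * m
        · subst hkm
          exact ⟨by rw [htop], by omega⟩
        obtain ⟨x, y, hx, hxm, hy, hym, hfx, hfy, h4, hord, hlt, hgt⟩ :=
          hrule k (by omega) (by omega) (by omega)
        refine ⟨by omega, fun _ _ => ⟨y, x, by omega, by omega, by omega, by rw [hf y hy, hfy],
          by rw [hf x hx, hfx], fun z hz hz' => ?_, fun z hz hz' => ?_⟩⟩
        · rw [hf z (by omega)]
          exact hgt z (by omega)
        · rw [hf z (by omega)]
          exact hlt z (by omega)
  · rw [hev]
    apply List.map_congr_left
    intro i _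
    exact congrArg (· / 2) (hf (2 * i + 2) (by omega)).symm

/-! ### Snow leopard permutations from leopard maps. -/

namespace IsLeopardMap
variable {m : ℕ} {f : ℕ → ℕ}

theorem pos_lt (h : IsLeopardMap m f) {k : ℕ} (hk : 1 ≤ k) (hkm : k < 4 * m) :
    1 ≤ f k ∧ f k < 4 * m := by
  have h0 := h.zero
  have htop := h.top
  have hle := h.le k hkm.le
  have e1 : f k ≠ f 0 := fun he => by
    have := h.inj (x := k) (y := 0) (by omega) (by omega) he
    omega
  have e2 : f k ≠ f (4 * m) := fun he => by
    have := h.inj (x := k) (y := 4 * m) (by omega) (by omega) he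
    omega
  omega

theorem mod_two (h : IsLeopardMap m f) {k : ℕ} (hk : k ≤ 4 * m) : f k % 2 = k % 2 := by
  by_cases h1 : k % 2 = 1
  · rw [h.odd k hk h1, h1]
  · by_cases h2 : k % 4 = 2
    · have := (h.up k hk h2).1
      omega
    · have := (h.down k hk (by omega)).1
      omega

/-- The neighbouring values of an even entry. -/
theorem around (h : IsLeopardMap m f) {k : ℕ} (hk : 1 ≤ k) (hkm : k < 4 * m) (hk2 : k % 2 = 0) :
    ∃ x y, x ≤ 4 * m ∧ y ≤ 4 * m ∧ f x + 1 = f k ∧ f y = f k + 1 ∧ f k % 4 = k % 4 ∧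
      (k % 4 = 2 ∧ x < k ∧ k < y ∨ k % 4 = 0 ∧ y < k ∧ k < x) ∧
      (∀ z, (x < z ∧ z < k ∨ k < z ∧ z < x) → f z < f k) ∧
      ∀ z, (k < z ∧ z < y ∨ y < z ∧ z < k) → f k < f z := by
  by_cases hk4 : k % 4 = 2
  · obtain ⟨h1, x, y, hx, hy, hym, hfx, hfy, hlt, hgt⟩ := h.up k hkm.le hk4
    exact ⟨x, y, by omega, hym, hfx, hfy, by omega, by omega, fun z hz => hlt z (by omega)
      (by omega), fun z hz => hgt z (by omega) (by omega)⟩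
  · have h1 := h.down k hkm.le (by omega)
    obtain ⟨x, y, hx, hy, hym, hfx, hfy, hlt, hgt⟩ := h1.2 (by omega) hkm
    have h2 := h1.1
    clear h1
    exact ⟨y, x, by omega, by omega, hfy, hfx, by omega, by omega, fun z hz => hgt z (by omega)
      (by omega), fun z hz => hlt z (by omega) (by omega)⟩

theorem isCompleteBaxter (h : IsLeopardMap m f) (hm : 0 < m) :
    IsCompleteBaxter ((List.range (4 * m - 1)).map (fun i => f (i + 1))) := by
  have hent : ∀ k, 1 ≤ k → k ≤ 4 * m - 1 →
      entry ((List.range (4 * m - 1)).map (fun i => f (i + 1))) k = f k := by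
    intro k hk hkm
    rw [entry_map_range _ hk hkm, Nat.sub_add_cancel hk]
  refine ⟨isPermutation_map_range ?_ ?_, ?_, ?_, ?_⟩
  · intro i hi j hj hij
    have := h.inj (x := i + 1) (y := j + 1) (by omega) (by omega) hij
    omega
  · intro i hi
    have := h.pos_lt (k := i + 1) (by omega) (by omega)
    omega
  · rw [List.length_map, List.length_range, Nat.odd_iff]
    omega
  · intro k hk hkm
    rw [List.length_map, List.length_range] at hkm
    rw [hent k hk hkm, Nat.even_iff, Nat.even_iff, h.mod_two (by omega)]
  · intro i x y z hx hxm hy hym hfx hfy hz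
    rw [List.length_map, List.length_range] at hxm hym
    rw [hent x hx hxm] at hfx
    rw [hent y hy hym] at hfy
    rw [hent z (by omega) (by omega), Nat.odd_iff, Nat.even_iff]
    have hpx := h.mod_two (k := x) (by omega)
    have hpy := h.mod_two (k := y) (by omega)
    constructor
    -- The rule is applied at the even one of the two consecutive entries, here `i + 1` at position
    -- `y`; injectivity sharpens `f z < i + 1` to `f z < i`.
    · intro hi
      obtain ⟨x', y', hx', hy', hfx', -, -, -, hlt, -⟩ := h.around (k := y) hy (by omega) (by omega)
      have hxx : x' = x := h.inj hx' (by omega) (by omega)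
      subst hxx
      have h1 := hlt z (by omega)
      have h2 : f z ≠ f x' := fun he => by
        have := h.inj (x := z) (y := x') (by omega) (by omega) he
        omega
      omega
    · intro hi
      obtain ⟨x', y', hx', hy', -, hfy', -, -, -, hgt⟩ := h.around (k := x) hx (by omega) (by omega)
      have hyy : y' = y := h.inj hy' (by omega) (by omega)
      subst hyy
      have h1 := hgt z (by omega)
      have h2 : f z ≠ f y' := fun he => by
        have := h.inj (x := z) (y := y') (by omega) (by omega) he
        omega
      omega

theorem isDoublyAlternating (h : IsLeopardMap m f) :
    IsDoublyAlternating ((List.range (2 * m)).map (fun i => (f (2 * i + 1) + 1) / 2)) := by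
  constructor
  · intro s hs hsm
    rw [List.length_map, List.length_range] at hsm
    rw [entry_map_range _ hs (by omega), entry_map_range _ (by omega) hsm, Nat.odd_iff,
      Nat.even_iff]
    rw [show 2 * (s - 1) + 1 = 2 * s - 1 by omega, show 2 * (s + 1 - 1) + 1 = 2 * s + 1 by omega]
    obtain ⟨x, y, hx, hy, hfx, hfy, h4, hord, hlt, hgt⟩ :=
      h.around (k := 2 * s) (by omega) (by omega) (by omega)
    have h1 := h.mod_two (k := 2 * s - 1) (by omega)
    have h2 := h.mod_two (k := 2 * s + 1) (by omega)
    rcases hord with ⟨hs4, hxs, hsy⟩ | ⟨hs4, hys, hsx⟩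
    · have a1 : f (2 * s - 1) < f (2 * s) := by
        by_cases hx1 : x = 2 * s - 1
        · rw [← hx1]
          omega
        · exact hlt _ (by omega)
      have a2 : f (2 * s) < f (2 * s + 1) := by
        by_cases hy1 : y = 2 * s + 1
        · rw [← hy1]
          omega
        · exact hgt _ (by omega)
      clear hlt hgt
      omega
    · have a1 : f (2 * s) < f (2 * s - 1) := by
        by_cases hy1 : y = 2 * s - 1
        · rw [← hy1]
          omega
        · exact hgt _ (by omega)
      have a2 : f (2 * s + 1) < f (2 * s) := by
        by_cases hx1 : x = 2 * s + 1
        · rw [← hx1]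
          omega
        · exact hlt _ (by omega)
      clear hlt hgt
      omega
  · intro t ht htm
    have hlen : (inverse ((List.range (2 * m)).map (fun i => (f (2 * i + 1) + 1) / 2))).length =
        2 * m := by
      simp [inverse]
    rw [hlen] at htm
    have hent : ∀ x, x ≤ 4 * m → 1 ≤ f x → f x < 4 * m → f x % 2 = 1 →
        entry (inverse ((List.range (2 * m)).map (fun i => (f (2 * i + 1) + 1) / 2)))
          ((f x + 1) / 2) = (x + 1) / 2 := by
      intro x hxm hx hx' hx2
      have hx3 := h.mod_two hxm
      have := entry_inverse_map_range (n := 2 * m) (i := x / 2)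
        (g := fun i => (f (2 * i + 1) + 1) / 2) (fun i hi j hj hij => ?_) (by omega)
      · rw [show 2 * (x / 2) + 1 = x by omega] at this
        rw [this (by omega) (by omega)]
        omega
      · have h1 := h.mod_two (k := 2 * i + 1) (by omega)
        have h2 := h.mod_two (k := 2 * j + 1) (by omega)
        have := h.inj (x := 2 * i + 1) (y := 2 * j + 1) (by omega) (by omega) (by omega)
        omega
    obtain ⟨k, hk, hkv⟩ := h.surj (2 * t) (by omega)
    have hk1 : k ≠ 0 := by
      rintro rfl
      have := h.zero
      omega
    have hk2 : k ≠ 4 * m := by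
      rintro rfl
      have := h.top
      omega
    have hk3 := h.mod_two hk
    obtain ⟨x, y, hx, hy, hfx, hfy, h4, hord, -, -⟩ :=
      h.around (k := k) (by omega) (by omega) (by omega)
    have h1 := hent x hx (by omega) (by omega) (by omega)
    have h2 := hent y hy (by omega) (by omega) (by omega)
    have h3 := h.mod_two hx
    have h5 := h.mod_two hy
    rw [show (f x + 1) / 2 = t by omega] at h1
    rw [show (f y + 1) / 2 = t + 1 by omega] at h2
    rw [h1, h2, Nat.odd_iff, Nat.even_iff]
    omega

theorem isSnowLeopardWord (h : IsLeopardMap m f) (hm : 0 < m) :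
    IsSnowLeopardWord ((List.range (2 * m - 1)).map (fun i => f (2 * i + 2) / 2)) := by
  have hpar : ∀ i < 4 * m - 1, f (i + 1) % 2 = (i + 1) % 2 := fun i hi => h.mod_two (by omega)
  have hev := evenWord_map_range hpar
  have hod := oddWord_map_range hpar
  rw [show (4 * m - 1) / 2 = 2 * m - 1 by omega] at hev
  rw [show (4 * m - 1 + 1) / 2 = 2 * m by omega] at hod
  have hw := h.isCompleteBaxter hm
  exact ⟨⟨_, hw, hev⟩, _, ⟨_, hw, hod⟩, h.isDoublyAlternating, _, hw, hod, hev⟩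

theorem evenWord_eq (h : IsLeopardMap m f) :
    evenWord ((List.range (2 * m - 1)).map (fun i => f (2 * i + 2) / 2)) =
      (List.range (m - 1)).map (fun i => f (4 * (i + 1)) / 4) := by
  rw [evenWord_map_range, show (2 * m - 1) / 2 = m - 1 by omega]
  · apply List.map_congr_left
    intro i _
    rw [show 2 * (2 * i + 1) + 2 = 4 * (i + 1) by omega]
    omega
  · intro i hi
    obtain ⟨x, y, -, -, -, -, h4, -⟩ :=
      h.around (k := 2 * i + 2) (by omega) (by omega) (by omega)
    omega

theorem oddWord_eq (h : IsLeopardMap m f) :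
    oddWord ((List.range (2 * m - 1)).map (fun i => f (2 * i + 2) / 2)) = oddThreadWord m f := by
  rw [oddWord_map_range, show (2 * m - 1 + 1) / 2 = m by omega]
  · apply List.map_congr_left
    intro i hi
    rw [List.mem_range] at hi
    rw [show 2 * (2 * i) + 2 = 4 * i + 2 by omega]
    have := (h.up (4 * i + 2) (by omega) (by omega)).1
    omega
  · intro i hi
    obtain ⟨x, y, -, -, -, -, h4, -⟩ :=
      h.around (k := 2 * i + 2) (by omega) (by omega) (by omega)
    omega

end IsLeopardMap

/-! ### Even, odd and Janus threads -/

namespace PermWord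

/-- The word `1 ⊖ s`. -/
def prime : PermWord → List ℕ
  | anti => []
  | ofWord w => skewSumWord [1] w

theorem prime_injective {s t : PermWord} (h : s.prime = t.prime) : s = t := by
  cases s <;> cases t
  · rfl
  · simp [prime, skewSumWord] at h
  · simp [prime, skewSumWord] at h
  · rw [(skewSumWord_cancel h rfl).2]

theorem length_prime (s : PermWord) : (s.prime.length : ℤ) = s.length + 1 := by
  cases s
  · rfl
  · simp only [prime, length, length_skewSumWord, List.length_singleton]
    omega

theorem one_skewSum (s : PermWord) : one.skewSum s = ofWord s.prime := by
  cases s <;> rfl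

theorem prime_one_skewSum (s : PermWord) : (one.skewSum s).prime = skewSumWord [1] s.prime := by
  rw [one_skewSum]
  rfl

theorem prime_arch {w : List ℕ} (hw : IsBounded w) (s : PermWord) :
    (((one.directSum (ofWord w).compl).directSum one).skewSum (one.skewSum s)).prime =
      skewSumWord [1] (skewSumWord (directSumWord (complWord (ofWord w).prime) [1]) s.prime) := by
  rw [one_skewSum, prime.eq_def (ofWord w)]
  simp only
  rw [complWord_skewSumWord _ hw, complWord_one]
  rfl

/-- The extra entry `f 0 / 4 = m` of `evenThreadWord` is the leading 1 of `1 ⊖ s`, and `m = 0`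
corresponds to `@`. Odd threads need no such correction, because `@` induces `∅` on its odd entries.
-/
theorem isEvenThread_iff (s : PermWord) : s.IsEvenThread ↔ Thread true s.prime := by
  have key : ∀ m f, IsLeopardMap m f → 0 < m →
      (ofWord (evenWord ((List.range (2 * m - 1)).map (fun i => f (2 * i + 2) / 2)))).prime =
        evenThreadWord m f := by
    intro m f h hm
    rw [h.evenWord_eq]
    obtain ⟨m, rfl⟩ := Nat.exists_eq_succ_of_ne_zero hm.ne'
    have h0 := h.zero
    rw [evenThreadWord, List.range_succ_eq_map]
    simp [prime, skewSumWord, h0]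
  constructor
  · rintro ⟨p, hp, hodd, rfl⟩
    cases p with
    | anti => exact Thread.nil _
    | ofWord v =>
      obtain ⟨m, f, h, hm, rfl⟩ := exists_isLeopardMap_of_isSnowLeopardWord hp (by
        simpa [length] using hodd)
      rw [evenPart, key m f h hm]
      exact h.thread.1
  · intro hs
    obtain ⟨m, f, h, hsf⟩ := hs.exists_isLeopardMap
    rcases Nat.eq_zero_or_pos m with rfl | hm
    · exact ⟨anti, trivial, by decide, (prime_injective (t := anti) hsf).symm⟩
    · refine ⟨ofWord _, h.isSnowLeopardWord hm, ?_, ?_⟩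
      · simp only [length, List.length_map, List.length_range]
        exact_mod_cast Nat.odd_iff.2 (by omega)
      · exact prime_injective ((key m f h hm).trans hsf.symm)

theorem isOddThread_iff (s : PermWord) :
    s.IsOddThread ↔ ∃ w, s = ofWord w ∧ Thread false w := by
  constructor
  · rintro ⟨p, hp, hodd, rfl⟩
    cases p with
    | anti => exact ⟨[], rfl, Thread.nil _⟩
    | ofWord v =>
      obtain ⟨m, f, h, hm, rfl⟩ := exists_isLeopardMap_of_isSnowLeopardWord hp (by
        simpa [length] using hodd)
      exact ⟨_, rfl, by rw [h.oddWord_eq]; exact h.thread.2⟩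
  · rintro ⟨w, rfl, hw⟩
    obtain ⟨m, f, h, hwf⟩ := hw.exists_isLeopardMap
    rcases Nat.eq_zero_or_pos m with rfl | hm
    · exact ⟨anti, trivial, by decide, congrArg ofWord hwf.symm⟩
    · refine ⟨ofWord _, h.isSnowLeopardWord hm, ?_, ?_⟩
      · simp only [length, List.length_map, List.length_range]
        exact_mod_cast Nat.odd_iff.2 (by omega)
      · exact congrArg ofWord (h.oddWord_eq.trans hwf.symm)

/-- A leading 1 can be added to or removed from an odd thread, so the odd condition may also be
stated for `1 ⊖ s`. This form includes `@`. -/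
theorem isJanusThread_iff (s : PermWord) :
    s.IsJanusThread ↔ Thread true s.prime ∧ Thread false s.prime := by
  rw [IsJanusThread, isEvenThread_iff, isOddThread_iff]
  constructor
  · rintro (rfl | ⟨he, w, rfl, hw⟩)
    · exact ⟨Thread.nil _, Thread.nil _⟩
    · exact ⟨he, (Thread.one _).append hw⟩
  · rintro ⟨he, ho⟩
    cases s with
    | anti => exact Or.inl rfl
    | ofWord w =>
      refine Or.inr ⟨he, w, rfl, ho.of_one_skewSumWord he.isBounded_of_one_skewSumWord⟩

end PermWord

/-! ### Peakless Motzkin paths -/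

theorem height_append (p q : List Step) : height (p ++ q) = height p + height q := by
  simp [height]

theorem height_cons (s : Step) (q : List Step) : height (s :: q) = s.rise + height q := by
  simp [height]

namespace JanusTree

/-- The Motzkin path of a term. -/
def path : JanusTree → List Step
  | nil => []
  | lev t => Step.L :: t.path
  | arch s t => Step.U :: (s.path ++ Step.D :: t.path)

theorem length_path (t : JanusTree) : t.path.length = t.word.length := by
  induction t with
  | nil => rfl
  | lev t ih =>
    simp [path, word, ih]
    omega
  | arch s t ihs iht =>
    simp [path, word, ihs, iht]
    omega

theorem path_eq_nil {t : JanusTree} : t.path = [] ↔ t = nil := by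
  cases t <;> simp [path]

theorem height_path (t : JanusTree) : height t.path = 0 := by
  induction t with
  | nil => rfl
  | lev t ih => simp [path, height_cons, Step.rise, ih]
  | arch s t ihs iht => simp [path, height_cons, height_append, Step.rise, ihs, iht]

theorem height_prefix_nonneg (t : JanusTree) : ∀ q, q <+: t.path → 0 ≤ height q := by
  induction t with
  | nil =>
    intro q hq
    rw [path, List.prefix_nil] at hq
    rw [hq]
    rfl
  | lev t ih =>
    intro q hq
    rw [path, List.prefix_cons_iff] at hq
    rcases hq with rfl | ⟨q', rfl, hq'⟩
    · rfl
    · have := ih q' hq'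
      rw [height_cons, Step.rise]
      omega
  | arch s t ihs iht =>
    intro q hq
    rw [path, List.prefix_cons_iff] at hq
    rcases hq with rfl | ⟨q', rfl, hq'⟩
    · rfl
    rw [height_cons, Step.rise]
    rcases List.prefix_or_prefix_of_prefix hq' (List.prefix_append s.path _) with h | ⟨r, rfl⟩
    · have := ihs q' h
      omega
    · rw [List.prefix_append_right_inj, List.prefix_cons_iff] at hq'
      rw [height_append, s.height_path]
      rcases hq' with rfl | ⟨r', rfl, hr⟩
      · simp [height]
      · have := iht r' hr
        rw [height_cons, Step.rise]
        omega

theorem isMotzkin_path (t : JanusTree) : IsMotzkin t.path :=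
  ⟨t.height_prefix_nonneg, t.height_path⟩

/-- The closing `D` marks where a path ends, so paths followed by `D` form a prefix code; this
generality is what the induction needs under an arch. -/
theorem path_append_injective {t t' : JanusTree} {r r' : List Step}
    (h : t.path ++ Step.D :: r = t'.path ++ Step.D :: r') : t = t' ∧ r = r' := by
  induction t generalizing t' r r' with
  | nil => cases t' <;> simp_all [path]
  | lev t ih =>
    cases t' with
    | lev t' =>
      simp only [path, List.cons_append, List.cons.injEq, true_and] at h
      obtain ⟨rfl, rfl⟩ := ih h
      exact ⟨rfl, rfl⟩
    | _ => simp [path] at h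
  | arch s t ihs iht =>
    cases t' with
    | arch s' t' =>
      simp only [path, List.cons_append, List.append_assoc, List.cons.injEq, true_and] at h
      obtain ⟨rfl, h'⟩ := ihs h
      obtain ⟨rfl, rfl⟩ := iht h'
      exact ⟨rfl, rfl⟩
    | _ => simp [path] at h

theorem path_injective {t t' : JanusTree} (h : t.path = t'.path) : t = t' :=
  (path_append_injective (r := []) (r' := []) (by rw [h])).1

/-- First-passage decomposition: a walk ending below 0 is a Motzkin path up to its first step to
height `-1`. After an initial `U` it is applied twice, once to return to 0 and once to go below. -/
theorem exists_path_append_of_height_neg : ∀ (n : ℕ) (q : List Step), q.length ≤ n →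
    height q < 0 → ∃ t : JanusTree, ∃ r, q = t.path ++ Step.D :: r := by
  intro n
  induction n with
  | zero =>
    intro q hq hneg
    rw [List.length_eq_zero_iff.1 (Nat.le_zero.1 hq)] at hneg
    simp [height] at hneg
  | succ n ih =>
    intro q hq hneg
    match q with
    | [] => simp [height] at hneg
    | Step.D :: q => exact ⟨nil, q, rfl⟩
    | Step.L :: q =>
      rw [height_cons, Step.rise] at hneg
      rw [List.length_cons] at hq
      obtain ⟨t, r, rfl⟩ := ih q (by omega) (by omega)
      exact ⟨lev t, r, rfl⟩
    | Step.U :: q =>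
      rw [height_cons, Step.rise] at hneg
      rw [List.length_cons] at hq
      obtain ⟨s, q', rfl⟩ := ih q (by omega) (by omega)
      rw [height_append, height_path, height_cons, Step.rise] at hneg
      rw [List.length_append, List.length_cons] at hq
      obtain ⟨t, r, rfl⟩ := ih q' (by omega) (by omega)
      exact ⟨arch s t, r, by simp [path]⟩

theorem exists_path_eq {p : List Step} (hp : IsMotzkin p) : ∃ t : JanusTree, t.path = p := by
  -- The appended `D` forces a first passage to `-1`. It cannot occur earlier, as that would give a
  -- prefix of `p` of negative height.
  obtain ⟨t, r, h⟩ := exists_path_append_of_height_neg _ (p ++ [Step.D]) le_rfl (by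
    rw [height_append, hp.2]
    decide)
  rcases List.eq_nil_or_concat r with rfl | ⟨r', c, rfl⟩
  · exact ⟨t, (List.append_inj' h rfl).1.symm⟩
  · exfalso
    rw [List.concat_eq_append, show t.path ++ Step.D :: (r' ++ [c]) =
      ((t.path ++ [Step.D]) ++ r') ++ [c] by simp] at h
    have := hp.1 (t.path ++ [Step.D]) ⟨r', (List.append_inj' h rfl).1.symm⟩
    rw [height_append, height_path] at this
    exact absurd this (by decide)

theorem good_of_isPeakless {t : JanusTree} (h : IsPeakless t.path) : t.Good := by
  induction t with
  | nil => trivial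
  | lev t ih => exact ih fun hi => h (hi.trans (List.suffix_cons _ _).isInfix)
  | arch s t ihs iht =>
    refine ⟨?_, ihs fun hi => h (hi.trans ⟨[Step.U], Step.D :: t.path, by simp [path]⟩),
      iht fun hi => h (hi.trans ⟨Step.U :: (s.path ++ [Step.D]), [], by simp [path]⟩)⟩
    rintro rfl
    exact h ⟨[], t.path, rfl⟩

/-- The relation between consecutive steps of a peakless path. -/
def NoPeak (a b : Step) : Prop := ¬(a = Step.U ∧ b = Step.D)

theorem head?_path_ne (t : JanusTree) : t.path.head? ≠ some Step.D := by
  cases t <;> simp [path]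

theorem getLast?_path_ne (t : JanusTree) : t.path.getLast? ≠ some Step.U := by
  induction t with
  | nil => simp [path]
  | lev t ih =>
    rw [path, List.getLast?_cons]
    cases h : t.path.getLast? <;> simp_all
  | arch s t _ ih =>
    rw [path, List.getLast?_cons, List.getLast?_append, List.getLast?_cons]
    cases h : t.path.getLast? <;> simp_all

/-- Peaks could only arise at the junctions of an arch: after `U` because `s` is empty or starts
with `D`, or before `D` because `s` ends with `U`. Goodness excludes the first and no path has the
other two properties. -/
theorem isChain_path {t : JanusTree} (h : t.Good) : List.IsChain NoPeak t.path := by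
  induction t with
  | nil => exact List.isChain_nil
  | lev t ih =>
    rw [path, List.isChain_cons]
    exact ⟨fun _ _ hc => by simp at hc, ih h⟩
  | arch s t ihs iht =>
    rw [path, List.isChain_cons, List.isChain_append, List.isChain_cons]
    refine ⟨?_, ihs h.2.1, ⟨fun _ _ hc => by simp at hc, iht h.2.2⟩, ?_⟩
    · rintro y hy ⟨-, rfl⟩
      rw [List.head?_append] at hy
      cases hs : s.path.head? with
      | none => exact h.1 (path_eq_nil.1 (List.head?_eq_none_iff.1 hs))
      | some c =>
        rw [hs] at hy
        simp at hy
        exact s.head?_path_ne (by rw [hs, hy])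
    · rintro x hx y - ⟨rfl, -⟩
      exact s.getLast?_path_ne hx

theorem isPeakless_path {t : JanusTree} (h : t.Good) : IsPeakless t.path := by
  intro hi
  have := (isChain_path h).infix hi
  simp [NoPeak] at this

end JanusTree

/-! ### The bijection -/

theorem JanusThread.exists_tree (g : JanusThread) :
    ∃ t : JanusTree, t.Good ∧ t.word = g.1.prime := by
  obtain ⟨h1, h2⟩ := (PermWord.isJanusThread_iff _).1 g.2
  exact JanusTree.exists_word_eq _ _ le_rfl h1 h2

/-- The term of a Janus thread. -/
noncomputable def JanusThread.tree (g : JanusThread) : JanusTree := g.exists_tree.choose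

theorem JanusThread.good_tree (g : JanusThread) : g.tree.Good := g.exists_tree.choose_spec.1

theorem JanusThread.word_tree (g : JanusThread) : g.tree.word = g.1.prime :=
  g.exists_tree.choose_spec.2

theorem JanusThread.tree_eq {g : JanusThread} {t : JanusTree} (ht : t.Good)
    (h : g.1.prime = t.word) : g.tree = t :=
  JanusTree.word_injective g.good_tree ht (g.word_tree.trans h)

theorem isJanusThread_of_prime_eq {s : PermWord} {t : JanusTree} (h : s.prime = t.word) :
    s.IsJanusThread := by
  rw [PermWord.isJanusThread_iff, h]
  exact ⟨t.thread_word _, t.thread_word _⟩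

theorem JanusTree.exists_janusThread (t : JanusTree) : ∃ g : JanusThread, g.1.prime = t.word := by
  cases t with
  | nil => exact ⟨⟨.anti, Or.inl rfl⟩, rfl⟩
  | lev t => exact ⟨⟨.ofWord t.word, isJanusThread_of_prime_eq (t := .lev t) rfl⟩, rfl⟩
  | arch s t =>
    exact ⟨⟨.ofWord _, isJanusThread_of_prime_eq (t := .arch s t) rfl⟩, rfl⟩

theorem JanusThread.ext_prime {g g' : JanusThread} (h : g.1.prime = g'.1.prime) : g = g' :=
  Subtype.ext (PermWord.prime_injective h)

/-- The Motzkin path of a Janus thread. -/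
noncomputable def JanusThread.toPath (g : JanusThread) : PeaklessMotzkinPath :=
  ⟨g.tree.path, g.tree.isMotzkin_path, JanusTree.isPeakless_path g.good_tree⟩

theorem JanusThread.toPath_eq {g : JanusThread} {t : JanusTree} (ht : t.Good)
    (h : g.1.prime = t.word) : g.toPath.1 = t.path :=
  congrArg JanusTree.path (tree_eq ht h)

theorem JanusThread.length_toPath (g : JanusThread) :
    (g.toPath.1.length : ℤ) = g.1.length + 1 := by
  rw [← PermWord.length_prime, ← g.word_tree, ← JanusTree.length_path]
  rfl

theorem JanusThread.toPath_injective : Function.Injective JanusThread.toPath := by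
  intro g g' h
  apply ext_prime
  rw [← g.word_tree, ← g'.word_tree, JanusTree.path_injective (congrArg Subtype.val h)]

theorem JanusThread.toPath_surjective : Function.Surjective JanusThread.toPath := by
  rintro ⟨p, hp, hp'⟩
  obtain ⟨t, rfl⟩ := JanusTree.exists_path_eq hp
  obtain ⟨g, hg⟩ := t.exists_janusThread
  exact ⟨g, Subtype.ext (toPath_eq (JanusTree.good_of_isPeakless hp') hg)⟩

theorem JanusThread.bijOn_toPath (n : ℤ) : Set.BijOn JanusThread.toPath (JT n) (UD (n + 1)) := by
  refine ⟨fun g hg => ?_, toPath_injective.injOn, fun p hp => ?_⟩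
  · have hg' : g.1.length = n := hg
    change (g.toPath.1.length : ℤ) = n + 1
    rw [g.length_toPath, hg']
  · obtain ⟨g, rfl⟩ := toPath_surjective p
    have hp' : (g.toPath.1.length : ℤ) = n + 1 := hp
    rw [g.length_toPath] at hp'
    exact ⟨g, show g.1.length = n by omega, rfl⟩

theorem JanusThread.prime_one_skewSum_eq (g : JanusThread) :
    (PermWord.one.skewSum g.1).prime = g.tree.lev.word := by
  rw [PermWord.prime_one_skewSum, JanusTree.word, g.word_tree]

theorem JanusThread.prime_arch_eq (g₁ g₂ : JanusThread) (h : 0 ≤ g₁.1.length) :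
    (((PermWord.one.directSum g₁.1.compl).directSum PermWord.one).skewSum
      (PermWord.one.skewSum g₂.1)).prime = (g₁.tree.arch g₂.tree).word := by
  rw [JanusTree.word, g₁.word_tree, g₂.word_tree]
  have hj := ((PermWord.isJanusThread_iff _).1 g₁.2).1
  cases hs : g₁.1 with
  | anti =>
    rw [hs] at h
    simp [PermWord.length] at h
  | ofWord w =>
    rw [hs] at hj
    exact PermWord.prime_arch hj.isBounded_of_one_skewSumWord g₂.1

theorem JanusThread.tree_ne_nil {g : JanusThread} (h : 0 ≤ g.1.length) : g.tree ≠ .nil := by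
  intro h0
  have h1 := g.1.length_prime
  rw [← g.word_tree, h0] at h1
  simp [JanusTree.word] at h1
  omega

theorem JanusThread.length_nonneg {g : JanusThread} {t : JanusTree} (ht : t ≠ .nil)
    (h : g.1.prime = t.word) : 0 ≤ g.1.length := by
  have h1 := g.1.length_prime
  have h2 := List.length_pos_of_ne_nil (mt JanusTree.word_eq_nil.1 ht)
  rw [h] at h1
  omega

end JanusThreads

theorem theorem6p4 :
    ∃! K : JanusThreads.JanusThread → JanusThreads.PeaklessMotzkinPath,
      (∀ n : ℤ, -1 ≤ n → Set.BijOn K (JanusThreads.JT n) (JanusThreads.UD (n + 1))) ∧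
      (∃ h : JanusThreads.PermWord.anti.IsJanusThread,
        (K ⟨JanusThreads.PermWord.anti, h⟩).1 = []) ∧
      (∃ h : JanusThreads.PermWord.empty.IsJanusThread,
        (K ⟨JanusThreads.PermWord.empty, h⟩).1 = [JanusThreads.Step.L]) ∧
      (∀ g₁ : JanusThreads.JanusThread,
        ∃ h : (JanusThreads.PermWord.one.skewSum g₁.1).IsJanusThread,
          (K ⟨JanusThreads.PermWord.one.skewSum g₁.1, h⟩).1
            = [JanusThreads.Step.L] ++ (K g₁).1) ∧
      (∀ g₁ g₂ : JanusThreads.JanusThread, 0 ≤ g₁.1.length →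
        ∃ h : (((JanusThreads.PermWord.one.directSum g₁.1.compl).directSum
            JanusThreads.PermWord.one).skewSum
              (JanusThreads.PermWord.one.skewSum g₂.1)).IsJanusThread,
          (K ⟨((JanusThreads.PermWord.one.directSum g₁.1.compl).directSum
            JanusThreads.PermWord.one).skewSum
              (JanusThreads.PermWord.one.skewSum g₂.1), h⟩).1
            = [JanusThreads.Step.U] ++ (K g₁).1 ++ [JanusThreads.Step.D] ++ (K g₂).1) := by
  open JanusThreads in
  refine ⟨JanusThread.toPath, ⟨fun n _ => JanusThread.bijOn_toPath n,
    ⟨isJanusThread_of_prime_eq (t := .nil) rfl, JanusThread.toPath_eq (t := .nil) trivial rfl⟩,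
    ⟨isJanusThread_of_prime_eq (t := .lev .nil) rfl,
      JanusThread.toPath_eq (t := .lev .nil) trivial rfl⟩, fun g₁ => ?_, fun g₁ g₂ h0 => ?_⟩, ?_⟩
  · exact ⟨isJanusThread_of_prime_eq g₁.prime_one_skewSum_eq,
      JanusThread.toPath_eq (t := g₁.tree.lev) g₁.good_tree g₁.prime_one_skewSum_eq⟩
  · refine ⟨isJanusThread_of_prime_eq (g₁.prime_arch_eq g₂ h0), ?_⟩
    refine (JanusThread.toPath_eq (g := ⟨_, _⟩) (t := g₁.tree.arch g₂.tree)
      ⟨JanusThread.tree_ne_nil h0, g₁.good_tree, g₂.good_tree⟩ (g₁.prime_arch_eq g₂ h0)).trans ?_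
    simp [JanusTree.path, JanusThread.toPath]
  -- The value at `@` and the two recursions suffice for uniqueness, by induction on the term of a
  -- Janus thread; the value at `∅ = 1 ⊖ @` is already implied.
  · rintro K ⟨-, ⟨hj, hanti⟩, -, hlev, harch⟩
    have key : ∀ t : JanusTree, t.Good → ∀ g : JanusThread, g.1.prime = t.word →
        (K g).1 = t.path := by
      intro t
      induction t with
      | nil =>
        intro _ g hg
        have : g = ⟨PermWord.anti, hj⟩ := JanusThread.ext_prime hg
        rw [this, hanti]
        rfl
      | lev t ih =>
        intro ht g hg
        obtain ⟨g₁, hg₁⟩ := t.exists_janusThread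
        obtain ⟨h, hK⟩ := hlev g₁
        have : g = ⟨_, h⟩ := JanusThread.ext_prime (by
          rw [hg, PermWord.prime_one_skewSum, hg₁, JanusTree.word])
        rw [this, hK, ih ht g₁ hg₁]
        rfl
      | arch s t ihs iht =>
        intro ht g hg
        obtain ⟨g₁, hg₁⟩ := s.exists_janusThread
        obtain ⟨g₂, hg₂⟩ := t.exists_janusThread
        have h0 := JanusThread.length_nonneg ht.1 hg₁
        obtain ⟨h, hK⟩ := harch g₁ g₂ h0
        have : g = ⟨_, h⟩ := JanusThread.ext_prime (by
          rw [hg, g₁.prime_arch_eq g₂ h0, JanusThread.tree_eq ht.2.1 hg₁,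
            JanusThread.tree_eq ht.2.2 hg₂])
        rw [this, hK, ihs ht.2.1 g₁ hg₁, iht ht.2.2 g₂ hg₂]
        simp [JanusTree.path]
    funext g
    exact Subtype.ext (key g.tree g.good_tree g g.word_tree.symm)
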